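/- Fix integers $r\ge 2$, $1\le i\le r$, $J\ge 0$, put $\ell=r-i+1$, and let $\mathbb F$ be a field of characteristic zero. **The series $\mathcal C_k(q)$.** For $1\le j\le r$ let $$\mathcal C_j(q)=\prod_{\substack{m\ge 1,\ m\not\equiv 2\,(4)\\ m\not\equiv 0,\,2r\pm(2j-1)\,(4r)}}\frac1{1-q^m},$$ and define $\mathcal C_k(q)$ for all $k\geq 1$ recursively, in the field $\mathbb Q((q))$ of formal Laurent series, by: for $g\ge1$, $\mathcal C_{(r-1)g+1}=\mathcal C_{(r-1)(g-1)+r}$ and, for $2\le j\le r$, $$\mathcal C_{(r-1)g+j}=\frac{\mathcal C_{(r-1)(g-1)+r-j+1}-\mathcal C_{(r-1)(g-1)+r-j+2}}{q^{2g(j-1)}}-\frac{\mathcal C_{(r-1)g+j-1}}{q}.$$ **The partitions.** $E_{r,i,J}(n)$ is the number of partitions $\lambda_1\ge\dots\ge\lambda_s$ of $n$ such that no odd part is repeated; whenever $m+r-1\le s$, $\lambda_m-\lambda_{m+r-1}\ge2$ if $\lambda_m$ is odd and $\lambda_m-\lambda_{m+r-1}\ge3$ if $\lambda_m$ is even; all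 parts are greater than $2J$; and at most $i-1$ parts are equal to $2J+1$ or $2J+2$. (So $E_{r,i,J}(0)=1$.) **The algebras.** For $k\ge1$ let $S_k=\mathbb F[x_k,x_{k+1},\dots]$, graded by giving $x_n$ weight $n$. For a homogeneous ideal $I$ of $S_k$ let $\mathrm{HP}(S_k/I)=\sum_{j\ge0}\dim_{\mathbb F}(S_k/I)_j\,q^j$. For $t\ge k$ let $G_t$ be the set of all monomials $$x_{2a-1}^2,\quad x_{2b-1}x_{2b}^{r-1},\quad x_{2c}^{r-n_1}x_{2c+2}^{n_1},\quad x_{2c}^{r-n_2-1}x_{2c+1}x_{2c+2}^{n_2}$$ with $2a-1,2b-1,2c\ge t$, $0\le n_1\le r-1$, $0\le n_2\le r-2$. Let $L_{r,i,J}$ be the ideal of $S_{2J+1}$ generated by $x_{2J+1}^2$, $x_{2J+1}x_{2J+2}^{i-1}$, $x_{2J+2}^i$ and $G_{2J+2}$. With $k=2J+1$, let $L_{2J+1}^{i}$ be the ideal of $S_{2J+1}$ generated by $x_k^2$, $x_kx_{k+1}^{i-1}$, $x_{k+1}^{i}$, the monomials $x_{k+1}^{e}x_{k+3}^{r-e}$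 and $x_{k+1}^{e}x_{k+2}x_{k+3}^{r-1-e}$ for $1\le e\le i-1$, and $G_{k+2}$; put $\mathrm{HP}_i^{2J+1}=\mathrm{HP}(S_{2J+1}/L_{2J+1}^{i})$. **Theorem.** The Laurent series $\mathcal C_{(r-1)J+\ell}(q)$ is a power series, and $$\mathcal C_{(r-1)J+\ell}(q)=\mathrm{HP}_i^{2J+1}=\mathrm{HP}(S_{2J+1}/L_{r,i,J})=\sum_{n\ge0}E_{r,i,J}(n)\,q^n .$$ -/

import Mathlib

open scoped PowerSeries LaurentSeries PowerSeries.WithPiTopology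

namespace GGA

/-! ### The `q`-series -/

/-- The product of `1 / (1 - q ^ m)` over all `m ≥ 1` with `m ≢ 2 (mod 4)` and
`m ≢ 0, 2r ± (2i - 1) (mod 4r)`, as a formal power series (the infinite product converges
coefficientwise, see `multipliable_productSeries`). -/
noncomputable def productSeries (r i : ℕ) : ℚ⟦X⟧ :=
  ∏' m : ℕ,
    if 1 ≤ m ∧ ¬ m ≡ 2 [MOD 4] ∧ ¬ m ≡ 0 [MOD 4 * r] ∧
        ¬ (m : ℤ) ≡ 2 * r + (2 * i - 1) [ZMOD 4 * r] ∧
        ¬ (m : ℤ) ≡ 2 * r - (2 * i - 1) [ZMOD 4 * r]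
    then ((1 : ℚ⟦X⟧) - PowerSeries.X ^ m)⁻¹ else 1

/-- The variable `q` in the field of formal Laurent series. -/
noncomputable def q : ℚ⸨X⸩ := ((PowerSeries.X : ℚ⟦X⟧) : ℚ⸨X⸩)

/-- `seriesPair r g i`, for `1 ≤ i ≤ r`, is the series with index `(r - 1) g + i`. The recursion
divides by powers of `q`, so it is read in the field of formal Laurent series. (The value at
`i = 0`, `g ≥ 1` is never used.) -/
noncomputable def seriesPair (r : ℕ) : ℕ → ℕ → ℚ⸨X⸩
  | 0, i => (productSeries r i : ℚ⸨X⸩)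
  | _ + 1, 0 => 0
  | g + 1, 1 => seriesPair r g r
  | g + 1, i + 2 =>
      (seriesPair r g (r - (i + 2) + 1) - seriesPair r g (r - (i + 2) + 2))
          / q ^ (2 * (g + 1) * (i + 1))
        - seriesPair r (g + 1) (i + 1) / q

/-- The sequence `𝒞_k(q)`, `k ≥ 1`, for a fixed `r ≥ 2`: write `k = (r - 1) g + i` with
`1 ≤ i ≤ r - 1`. It is characterized by `calC_initial`, `calC_rec_one` and `calC_rec`. -/
noncomputable def calC (r k : ℕ) : ℚ⸨X⸩ :=
  seriesPair r ((k - 1) / (r - 1)) ((k - 1) % (r - 1) + 1)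

/-! ### Partitions -/

/-- The partition `lam` (its parts `λ_1 ≥ λ_2 ≥ ⋯ ≥ λ_s` are listed, from index `0` on, by
`lam.parts.sort (· ≥ ·)`) is one of those counted by `E_{r,i,J}`. -/
def IsAdmissible (r i J : ℕ) {n : ℕ} (lam : n.Partition) : Prop :=
  (∀ a, Odd a → lam.parts.count a ≤ 1) ∧
  (∀ (m : ℕ) (h : m + (r - 1) < (lam.parts.sort (· ≥ ·)).length),
    (Odd ((lam.parts.sort (· ≥ ·))[m]) →
      (lam.parts.sort (· ≥ ·))[m + (r - 1)] + 2 ≤ (lam.parts.sort (· ≥ ·))[m]) ∧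
    (Even ((lam.parts.sort (· ≥ ·))[m]) →
      (lam.parts.sort (· ≥ ·))[m + (r - 1)] + 3 ≤ (lam.parts.sort (· ≥ ·))[m])) ∧
  (∀ a ∈ lam.parts, 2 * J < a) ∧
  lam.parts.count (2 * J + 1) + lam.parts.count (2 * J + 2) ≤ i - 1

/-- The number `E_{r,i,J}(n)`. -/
noncomputable def E (r i J n : ℕ) : ℕ :=
  Nat.card {lam : n.Partition // IsAdmissible r i J lam}

/-- The generating function of `E_{r,i,J}`. -/
noncomputable def calE (r i J : ℕ) : ℚ⟦X⟧ :=
  PowerSeries.mk fun n => (E r i J n : ℚ)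

/-! ### The graded algebras -/

section Algebra

variable (F : Type*) [Field F]

/-- `S_k = F[x_k, x_{k+1}, …]`. -/
abbrev S (k : ℕ) : Type _ := MvPolynomial {n : ℕ // k ≤ n} F

/-- The variable `x_n` of `S_k` (only used for `n ≥ k`). -/
noncomputable def x (k n : ℕ) : S F k :=
  if h : k ≤ n then MvPolynomial.X ⟨n, h⟩ else 0

/-- The weight-`j` part of `S_k`, the variable `x_n` having weight `n`. -/
noncomputable def weightPart (k j : ℕ) : Submodule F (S F k) :=
  MvPolynomial.weightedHomogeneousSubmodule F (fun n : {n : ℕ // k ≤ n} => (n : ℕ)) j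

/-- The degree-`j` part of `S_k / I`: the image of the weight-`j` part of `S_k`. -/
noncomputable def quotientPart (k : ℕ) (I : Ideal (S F k)) (j : ℕ) : Submodule F (S F k ⧸ I) :=
  (weightPart F k j).map (Ideal.Quotient.mkₐ F I).toLinearMap

/-- The Hilbert–Poincaré series of `S_k / I`, for a homogeneous ideal `I` and `k ≥ 1`
(all the dimensions are finite, see `finite_quotientPart`). -/
noncomputable def HP (k : ℕ) (I : Ideal (S F k)) : ℚ⟦X⟧ :=
  PowerSeries.mk fun j => (Module.finrank F (quotientPart F k I j) : ℚ)

/-- The monomials `x_{2a-1}^2`, `x_{2b-1} x_{2b}^{r-1}`, `x_{2c}^{r-n₁} x_{2c+2}^{n₁}` and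
`x_{2c}^{r-n₂-1} x_{2c+1} x_{2c+2}^{n₂}` with `2a-1, 2b-1, 2c ≥ t`, `0 ≤ n₁ ≤ r-1`,
`0 ≤ n₂ ≤ r-2`, in `S_k`. For `t = k` they generate the ideal `L_k`. -/
def gensL (k r t : ℕ) : Set (S F k) :=
  {f | ∃ m, Odd m ∧ t ≤ m ∧ f = x F k m ^ 2} ∪
  {f | ∃ m, Odd m ∧ t ≤ m ∧ f = x F k m * x F k (m + 1) ^ (r - 1)} ∪
  {f | ∃ m n, Even m ∧ t ≤ m ∧ n ≤ r - 1 ∧ f = x F k m ^ (r - n) * x F k (m + 2) ^ n} ∪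
  {f | ∃ m n, Even m ∧ t ≤ m ∧ n ≤ r - 2 ∧
    f = x F k m ^ (r - n - 1) * x F k (m + 1) * x F k (m + 2) ^ n}

/-- The ideal `L_{r,i,J}` of `S_{2J+1}`. -/
noncomputable def idealL (r i J : ℕ) : Ideal (S F (2 * J + 1)) :=
  Ideal.span
    ({x F (2 * J + 1) (2 * J + 1) ^ 2,
      x F (2 * J + 1) (2 * J + 1) * x F (2 * J + 1) (2 * J + 2) ^ (i - 1),
      x F (2 * J + 1) (2 * J + 2) ^ i} ∪
    gensL F (2 * J + 1) r (2 * J + 2))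

/-- Generators, in `S_k`, of the ideal `L_t^l` for even `t`. -/
def gensEven (k r t l : ℕ) : Set (S F k) :=
  {x F k t ^ l} ∪
  {f | ∃ e, 1 ≤ e ∧ e ≤ l - 1 ∧ f = x F k t ^ e * x F k (t + 2) ^ (r - e)} ∪
  {f | ∃ e, 1 ≤ e ∧ e ≤ l - 1 ∧
    f = x F k t ^ e * x F k (t + 1) * x F k (t + 2) ^ (r - 1 - e)} ∪
  gensL F k r (t + 1)

/-- The ideal `L_k^l` of `S_k`. -/
noncomputable def idealLevel (r k l : ℕ) : Ideal (S F k) :=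
  if Even k then Ideal.span (gensEven F k r k l)
  else Ideal.span
    ({x F k k ^ 2, x F k k * x F k (k + 1) ^ (l - 1)} ∪ gensEven F k r (k + 1) l)

end Algebra

/-! ### The definitions are meaningful -/

theorem multipliable_productSeries (p : ℕ → Prop) [DecidablePred p] :
    Multipliable fun m : ℕ =>
      if 1 ≤ m ∧ p m then ((1 : ℚ⟦X⟧) - PowerSeries.X ^ m)⁻¹ else 1 := by
  have key : (fun m : ℕ => if 1 ≤ m ∧ p m then ((1 : ℚ⟦X⟧) - PowerSeries.X ^ m)⁻¹ else 1) =
      fun m : ℕ => 1 + (if 1 ≤ m ∧ p m then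
        PowerSeries.X ^ m * ((1 : ℚ⟦X⟧) - PowerSeries.X ^ m)⁻¹ else 0) := by
    funext m
    split_ifs with h
    · have hc : PowerSeries.constantCoeff ((1 : ℚ⟦X⟧) - PowerSeries.X ^ m) ≠ 0 := by
        have : m ≠ 0 := by omega
        simp [this]
      have := PowerSeries.mul_inv_cancel _ hc
      linear_combination this
    · simp
  rw [key]
  apply PowerSeries.WithPiTopology.multipliable_one_add_of_tendsto_order_atTop_nhds_top
  refine ENat.tendsto_nhds_top_iff_natCast_lt.mpr
    (fun n => Filter.eventually_atTop.mpr ⟨n + 1, fun m hm => ?_⟩)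
  split_ifs with h
  · refine lt_of_lt_of_le ?_ (PowerSeries.le_order_mul _ _)
    refine lt_add_of_lt_of_nonneg ?_ (by simp)
    rw [PowerSeries.order_X_pow]
    exact_mod_cast hm
  · simp

theorem calC_eq_seriesPair {r : ℕ} (hr : 2 ≤ r) (g : ℕ) {i : ℕ} (hi : 1 ≤ i) (hir : i ≤ r) :
    calC r ((r - 1) * g + i) = seriesPair r g i := by
  obtain ⟨s, rfl⟩ : ∃ s, r = s + 1 := ⟨r - 1, by omega⟩
  obtain ⟨j, rfl⟩ : ∃ j, i = j + 1 := ⟨i - 1, by omega⟩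
  have hs : 0 < s := by omega
  unfold calC
  simp only [Nat.add_sub_cancel, ← add_assoc]
  rcases Nat.lt_or_ge j s with h | h
  · rw [Nat.mul_add_div hs, Nat.mul_add_mod, Nat.div_eq_of_lt h, Nat.mod_eq_of_lt h, add_zero]
  · obtain rfl : j = s := by omega
    rw [Nat.mul_add_div hs, Nat.mul_add_mod, Nat.div_self hs, Nat.mod_self, zero_add, seriesPair]

theorem calC_initial {r : ℕ} (hr : 2 ≤ r) {i : ℕ} (hi : 1 ≤ i) (hir : i ≤ r) :
    calC r i = (productSeries r i : ℚ⸨X⸩) := by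
  have h := calC_eq_seriesPair hr 0 hi hir
  rw [mul_zero, zero_add] at h
  rw [h, seriesPair]

theorem calC_rec_one {r : ℕ} (_hr : 2 ≤ r) {g : ℕ} (hg : 1 ≤ g) :
    calC r ((r - 1) * g + 1) = calC r ((r - 1) * (g - 1) + r) := by
  obtain ⟨h, rfl⟩ : ∃ h, g = h + 1 := ⟨g - 1, by omega⟩
  congr 1
  rw [Nat.add_sub_cancel, mul_add]
  omega

theorem calC_rec {r : ℕ} (hr : 2 ≤ r) {g : ℕ} (hg : 1 ≤ g) {i : ℕ} (hi : 2 ≤ i) (hir : i ≤ r) :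
    calC r ((r - 1) * g + i) =
      (calC r ((r - 1) * (g - 1) + (r - i + 1)) - calC r ((r - 1) * (g - 1) + (r - i + 2)))
          / q ^ (2 * g * (i - 1))
        - calC r ((r - 1) * g + (i - 1)) / q := by
  obtain ⟨h, rfl⟩ : ∃ h, g = h + 1 := ⟨g - 1, by omega⟩
  obtain ⟨j, rfl⟩ : ∃ j, i = j + 2 := ⟨i - 2, by omega⟩
  rw [calC_eq_seriesPair hr _ (by omega) hir, calC_eq_seriesPair hr _ (by omega) (by omega),
    calC_eq_seriesPair hr _ (by omega) (by omega), calC_eq_seriesPair hr _ (by omega) (by omega)]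
  rw [seriesPair]
  rfl

theorem finite_quotientPart (F : Type*) [Field F] {k : ℕ} (hk : 1 ≤ k) (I : Ideal (S F k))
    (j : ℕ) : Module.Finite F (quotientPart F k I j) := by
  have hfin : {d : {n : ℕ // k ≤ n} →₀ ℕ |
      Finsupp.weight (fun n : {n : ℕ // k ≤ n} => (n : ℕ)) d = j}.Finite := by
    have hs : {n : {n : ℕ // k ≤ n} | (n : ℕ) ≤ j}.Finite :=
      (Set.finite_Iic j).preimage Subtype.val_injective.injOn
    refine (Set.finite_Iic (∑ n ∈ hs.toFinset, Finsupp.single n j)).subset fun d hd => ?_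
    have hterm : ∀ n, d n * (n : ℕ) ≤ j := by
      intro n
      by_cases hn : n ∈ d.support
      · have hd' : ∑ m ∈ d.support, d m * (m : ℕ) = j := by
          simpa [Finsupp.weight_apply, Finsupp.sum] using hd
        rw [← hd']
        exact Finset.single_le_sum (f := fun m : {n : ℕ // k ≤ n} => d m * (m : ℕ))
          (fun _ _ => Nat.zero_le _) hn
      · simp [Finsupp.notMem_support_iff.mp hn]
    intro n
    rw [Finsupp.finsetSum_apply]
    by_cases h0 : d n = 0
    · rw [h0]; exact Nat.zero_le _
    have hn1 : 1 ≤ (n : ℕ) := hk.trans n.2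
    have h1 : 1 ≤ d n := Nat.one_le_iff_ne_zero.mpr h0
    have hnj : (n : ℕ) ≤ j := by nlinarith [hterm n]
    have hdj : d n ≤ j := by nlinarith [hterm n]
    refine hdj.trans ?_
    have hmem : n ∈ hs.toFinset := by simpa using hnj
    refine le_trans ?_ (Finset.single_le_sum
      (f := fun m : {n : ℕ // k ≤ n} => (Finsupp.single m j) n) (fun _ _ => Nat.zero_le _) hmem)
    simp
  have : Module.Finite F (weightPart F k j) := by
    unfold weightPart
    rw [MvPolynomial.weightedHomogeneousSubmodule_eq_finsupp_supported]
    have := hfin.to_subtype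
    exact Module.Finite.of_basis (MvPolynomial.basisRestrictSupport F
      {d : {n : ℕ // k ≤ n} →₀ ℕ |
        Finsupp.weight (fun n : {n : ℕ // k ≤ n} => (n : ℕ)) d = j})
  unfold quotientPart
  infer_instance

end GGA

namespace GGA

open PowerSeries Filter Topology

/-! ### Convergence of power series in the `X`-adic sense -/

/-! All the series are identified with one three-parameter family. Write `i = j + 1`, `r = j + s +
1`, so that `ℓ = s + 1`. The family is Andrews' `J_{r,i}(-1/q; q^(2g); q²)`, written `andrewsSeries
g j s`. Three facts drive the proof: `A g 0 s = A (g+1) s 0`; the recursion `andrewsSeries_succ`,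
expressing `A g (j+1) s - A g j (s+1)` through two series at level `g + 1`; and `A g j s ≡ 1` modulo
`q^g`. By `eq_of_recursion` they determine the family: modulo `q^N` it is known for `g ≥ N`, and the
recursion carries this knowledge down to every smaller `g`.

Partitions satisfy the same three facts. The difference conditions say exactly that every window of
sizes `2c, 2c+1, 2c+2` with `c > J` holds at most `r - 1` parts (`difference_conditions_iff`).
Removing the parts `2J+1` and `2J+2` turns the window condition at `c = J + 1` into the initial
condition at level `J + 1` (`admissibleMults_succ`). Hence
`genFun_admissibleMults_eq_andrewsSeries`.

The algebras give the same count. The ideals are monomial, so the Hilbert series counts the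
monomials divisible by no generator (`finrank_quotientPart_span`), and avoiding the generators is
again the window condition (`avoids_iff`). The two ideals coincide (`idealLevel_eq_idealL`).

The series `𝒞_k` solve the same recursion for its level `g + 1` terms, starting from level `0`. It
remains to match that level: `andrewsSum 0 j s` is a theta series, which Jacobi's triple product
turns into the product defining `productSeries` (`productSeries_eq`). The triple product comes from
the finite `q`-binomial theorem by letting the number of factors grow. -/

theorem isClosed_X_pow_dvd (K : ℕ) : IsClosed {f : ℚ⟦X⟧ | X ^ K ∣ f} := by
  have : {f : ℚ⟦X⟧ | X ^ K ∣ f} = ⋂ m : ℕ, ⋂ _ : m < K, {f | coeff m f = 0} := by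
    ext f
    simp [X_pow_dvd_iff]
  rw [this]
  exact isClosed_iInter fun m => isClosed_iInter fun _ =>
    isClosed_eq (WithPiTopology.continuous_coeff ℚ m) continuous_const

theorem tendsto_of_X_pow_dvd_sub {u : ℕ → ℚ⟦X⟧} {L : ℚ⟦X⟧} (h : ∀ N, X ^ N ∣ u N - L) :
    Tendsto u atTop (𝓝 L) := by
  rw [WithPiTopology.tendsto_iff_coeff_tendsto]
  intro d
  refine tendsto_const_nhds.congr' ?_
  filter_upwards [eventually_gt_atTop d] with N hN
  have := X_pow_dvd_iff.mp (h N) d hN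
  rw [map_sub, sub_eq_zero] at this
  exact this.symm

theorem eq_of_forall_X_pow_dvd_sub {f g : ℚ⟦X⟧} (h : ∀ N : ℕ, X ^ N ∣ f - g) : f = g := by
  ext d
  have := X_pow_dvd_iff.mp (h (d + 1)) d (Nat.lt_succ_self d)
  rwa [map_sub, sub_eq_zero] at this

/-- Divisibility of the `n`-th term by `X^n` is the uniform criterion used below for convergence of
both sums and products. -/
theorem tendsto_order_of_X_pow_dvd {f : ℕ → ℚ⟦X⟧} (h : ∀ n, X ^ n ∣ f n) :
    Tendsto (fun n => (f n).order) atTop (𝓝 ⊤) := by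
  refine ENat.tendsto_nhds_top_iff_natCast_lt.mpr
    (fun n => eventually_atTop.mpr ⟨n + 1, fun m hm => ?_⟩)
  refine lt_of_lt_of_le ?_ (nat_le_order _ m (X_pow_dvd_iff.mp (h m)))
  exact_mod_cast hm

theorem summable_of_X_pow_dvd {f : ℕ → ℚ⟦X⟧} (h : ∀ n, X ^ n ∣ f n) : Summable f :=
  WithPiTopology.summable_of_tendsto_order_atTop_nhds_top ℚ (tendsto_order_of_X_pow_dvd h)

theorem multipliable_of_X_pow_dvd_sub_one {f : ℕ → ℚ⟦X⟧} (h : ∀ n, X ^ n ∣ f n - 1) :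
    Multipliable f := by
  have := WithPiTopology.multipliable_one_add_of_tendsto_order_atTop_nhds_top ℚ
    (tendsto_order_of_X_pow_dvd h)
  simpa using this

theorem X_pow_dvd_tsum {f : ℕ → ℚ⟦X⟧} (hf : Summable f) {K : ℕ} (h : ∀ n, X ^ K ∣ f n) :
    X ^ K ∣ ∑' n, f n :=
  (isClosed_X_pow_dvd K).mem_of_tendsto hf.hasSum
    (Eventually.of_forall fun _ => Finset.dvd_sum fun n _ => h n)

theorem dvd_mul_sub_one {R : Type*} [CommRing R] {a x y : R} (hx : a ∣ x - 1) (hy : a ∣ y - 1) :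
    a ∣ x * y - 1 := by
  have : x * y - 1 = (x - 1) * y + (y - 1) := by ring
  rw [this]
  exact dvd_add (hx.mul_right y) hy

theorem dvd_prod_sub_one {R ι : Type*} [CommRing R] {a : R} {f : ι → R} (s : Finset ι)
    (h : ∀ n ∈ s, a ∣ f n - 1) : a ∣ ∏ n ∈ s, f n - 1 := by
  classical
  induction s using Finset.induction_on with
  | empty => simp
  | insert b s hb ih =>
    rw [Finset.prod_insert hb]
    exact dvd_mul_sub_one (h b (Finset.mem_insert_self b s))
      (ih fun n hn => h n (Finset.mem_insert_of_mem hn))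

theorem X_pow_dvd_tprod_sub_one {f : ℕ → ℚ⟦X⟧} (hf : Multipliable f) {K : ℕ}
    (h : ∀ n, X ^ K ∣ f n - 1) : X ^ K ∣ ∏' n, f n - 1 :=
  ((isClosed_X_pow_dvd K).preimage (f := fun x : ℚ⟦X⟧ => x - 1) (by fun_prop)).mem_of_tendsto
    hf.hasProd (Eventually.of_forall fun s => dvd_prod_sub_one s fun n _ => h n)

theorem dvd_sub_one_of_mul_eq {R : Type*} [CommRing R] {a x y z : R} (hx : a ∣ x - 1)
    (hz : a ∣ z - 1) (h : x * y = z) : a ∣ y - 1 := by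
  have : y - 1 = (z - 1) - (x - 1) * y := by rw [← h]; ring
  rw [this]
  exact dvd_sub hz (hx.mul_right y)

theorem tsum_nat_add_one {f : ℕ → ℚ⟦X⟧} (hf : Summable f) (h0 : f 0 = 0) :
    ∑' n, f (n + 1) = ∑' n, f n := by
  rw [hf.tsum_eq_zero_add, h0, zero_add]

/-! ### Two finite `q`-products -/

/-- `∏_{k < g} (1 - q ^ (2 n + 2 + 2 k))`. -/
noncomputable def evenProd (g n : ℕ) : ℚ⟦X⟧ :=
  ∏ k ∈ Finset.range g, (1 - X ^ (2 * n + 2 + 2 * k))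

/-- `∏_{k < g} (1 + q ^ (2 n + 1 + 2 k))`. -/
noncomputable def oddProd (g n : ℕ) : ℚ⟦X⟧ :=
  ∏ k ∈ Finset.range g, (1 + X ^ (2 * n + 1 + 2 * k))

theorem evenProd_succ (g n : ℕ) :
    evenProd (g + 1) n = evenProd g n * (1 - X ^ (2 * n + 2 + 2 * g)) :=
  Finset.prod_range_succ _ _

theorem evenProd_succ' (g n : ℕ) :
    evenProd (g + 1) n = evenProd g (n + 1) * (1 - X ^ (2 * n + 2)) := by
  rw [evenProd, Finset.prod_range_succ', evenProd]
  congr 1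
  refine Finset.prod_congr rfl fun k _ => ?_
  ring

theorem oddProd_succ (g n : ℕ) :
    oddProd (g + 1) n = oddProd g n * (1 + X ^ (2 * n + 1 + 2 * g)) :=
  Finset.prod_range_succ _ _

theorem oddProd_succ' (g n : ℕ) :
    oddProd (g + 1) n = oddProd g (n + 1) * (1 + X ^ (2 * n + 1)) := by
  rw [oddProd, Finset.prod_range_succ', oddProd]
  congr 1
  refine Finset.prod_congr rfl fun k _ => ?_
  ring

theorem constantCoeff_oddProd (g n : ℕ) : constantCoeff (oddProd g n) = 1 := by
  simp [oddProd, map_prod]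

theorem oddProd_mul_inv (g n : ℕ) : oddProd g n * (oddProd g n)⁻¹ = 1 :=
  PowerSeries.mul_inv_cancel _ (by rw [constantCoeff_oddProd]; exact one_ne_zero)

/-- This cancels the last factor of the denominator; the primed version cancels the first. The two
account for the shifts of `g` and of `n` in Andrews' recursion. -/
theorem one_add_X_pow_mul_inv_oddProd (g n : ℕ) :
    (1 + X ^ (2 * n + 1 + 2 * g)) * (oddProd (g + 1) n)⁻¹ = (oddProd g n)⁻¹ := by
  have h1 := oddProd_mul_inv (g + 1) n
  have h2 := oddProd_mul_inv g n
  rw [oddProd_succ] at h1 ⊢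
  linear_combination (oddProd g n)⁻¹ * h1 - (1 + X ^ (2 * n + 1 + 2 * g)) *
    (oddProd g n * (1 + X ^ (2 * n + 1 + 2 * g)))⁻¹ * h2

theorem one_add_X_pow_mul_inv_oddProd' (g n : ℕ) :
    (1 + X ^ (2 * n + 1)) * (oddProd (g + 1) n)⁻¹ = (oddProd g (n + 1))⁻¹ := by
  have h1 := oddProd_mul_inv (g + 1) n
  have h2 := oddProd_mul_inv g (n + 1)
  rw [oddProd_succ'] at h1 ⊢
  linear_combination (oddProd g (n + 1))⁻¹ * h1 - (1 + X ^ (2 * n + 1)) *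
    (oddProd g (n + 1) * (1 + X ^ (2 * n + 1)))⁻¹ * h2

/-! ### Andrews' series and their recursion -/

/-- The `n`-th term of the series `andrewsSum g j s`. -/
noncomputable def andrewsTerm (g j s n : ℕ) : ℚ⟦X⟧ :=
  (-1) ^ n * X ^ (2 * (j + s + 1) * n * (n + g) + n + 2 * s * n) *
    (evenProd g n * (oddProd (g + 1) n)⁻¹) *
    (1 - X ^ ((j + 1) * (4 * n + 2 * g + 2)) +
      X ^ (2 * n + 1 + 2 * g) * (1 - X ^ (j * (4 * n + 2 * g + 2))))

theorem le_andrews_exponent (r g n m : ℕ) : n ≤ 2 * (r + 1) * n * (n + g) + m := by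
  rcases Nat.eq_zero_or_pos n with rfl | hn
  · simp
  · have : n * 1 ≤ n * (2 * (r + 1) * (n + g)) := Nat.mul_le_mul_left n (by nlinarith)
    nlinarith

theorem X_pow_dvd_andrewsTerm (g j s n : ℕ) : X ^ n ∣ andrewsTerm g j s n := by
  unfold andrewsTerm
  refine Dvd.dvd.mul_right (Dvd.dvd.mul_right (Dvd.dvd.mul_left (pow_dvd_pow X ?_) _) _) _
  rw [add_assoc]
  exact le_andrews_exponent _ _ _ _

theorem summable_andrewsTerm (g j s : ℕ) : Summable (andrewsTerm g j s) :=
  summable_of_X_pow_dvd (X_pow_dvd_andrewsTerm g j s)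

/-- Andrews' series `J_{r,i}(-1/q; x; q²)` at `x = q ^ (2 g)`, without its infinite products,
where `i = j + 1` and `r = j + s + 1`. -/
noncomputable def andrewsSum (g j s : ℕ) : ℚ⟦X⟧ := ∑' n, andrewsTerm g j s n

theorem andrewsSum_zero (g s : ℕ) : andrewsSum g 0 s = andrewsSum (g + 1) s 0 := by
  -- On the left, `1 - q^(4n+2g+2) = (1 - q^(2n)) + q^(2n) (1 - q^(2n+2g+2))`: the first summand
  -- gives `γ n`, the second extends `evenProd` and gives `α n`. On the right the bracket is `(1 +
  -- q^(2n+2g+3))` minus a power of `q` times `(1 + q^(2n+1))`; cancelling in `oddProd` gives `α n`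
  -- and `γ (n + 1)`. Since `γ 0 = 0`, the sums agree.
  set α : ℕ → ℚ⟦X⟧ := fun n => (-1) ^ n * X ^ (2 * (s + 1) * n * (n + (g + 1)) + n) *
    (evenProd (g + 1) n * (oddProd (g + 1) n)⁻¹) with hα
  set γ : ℕ → ℚ⟦X⟧ := fun n => (-1) ^ n * X ^ (2 * (s + 1) * n * (n + g) + (2 * s + 1) * n) *
    ((1 - X ^ (2 * n)) * (evenProd g n * (oddProd (g + 1) n)⁻¹)) with hγ
  have h1 : ∀ n, andrewsTerm g 0 s n = α n + γ n := by
    intro n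
    simp only [hα, hγ, andrewsTerm, evenProd_succ]
    ring
  have h2 : ∀ n, andrewsTerm (g + 1) s 0 n = α n + γ (n + 1) := by
    intro n
    have e1 := one_add_X_pow_mul_inv_oddProd (g + 1) n
    have e2 := one_add_X_pow_mul_inv_oddProd' (g + 1) n
    simp only [hα, hγ, andrewsTerm]
    rw [← e1, ← e2, show evenProd (g + 1) n = evenProd g (n + 1) * (1 - X ^ (2 * n + 2)) from
      evenProd_succ' g n]
    ring
  have hαs : Summable α := summable_of_X_pow_dvd fun n => by
    refine Dvd.dvd.mul_right (Dvd.dvd.mul_left (pow_dvd_pow X ?_) _) _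
    exact le_andrews_exponent _ _ _ _
  have hγs : Summable γ := summable_of_X_pow_dvd fun n => by
    refine Dvd.dvd.mul_right (Dvd.dvd.mul_left (pow_dvd_pow X ?_) _) _
    exact le_andrews_exponent _ _ _ _
  have hγ0 : γ 0 = 0 := by simp [hγ]
  unfold andrewsSum
  rw [tsum_congr h1, tsum_congr h2, hαs.tsum_add hγs,
    hαs.tsum_add ((summable_nat_add_iff 1).mpr hγs), tsum_nat_add_one hγs hγ0]

/-- With `y = q^(2n+2g+1)`, `u = q^(2n+1)` and `T = 4n+2g+2`, so that `q^T = y u`, the brackets of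
the two level-`g` terms differ, after extracting the common power of `q`, by `(1 - q^(2n)) (1 + y) +
q^(jT+2n) y (1 + u) (1 - q^(2n+2g+2))`. The factors `1 + y` and `1 + u` cancel in `oddProd`, leaving
`γ n + δ n`. The level-`(g+1)` terms give `γ (n + 1) + δ n`, and `γ 0 = 0`. -/
theorem andrewsSum_succ (g j s : ℕ) :
    andrewsSum g (j + 1) s = andrewsSum g j (s + 1) +
      X ^ (2 * (g + 1) * j + 2 * g + 1) *
        (X * andrewsSum (g + 1) s (j + 1) + andrewsSum (g + 1) (s + 1) j) := by
  set γ : ℕ → ℚ⟦X⟧ := fun n => (-1) ^ n * X ^ (2 * (j + s + 1 + 1) * n * (n + g) + n + 2 * s * n) *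
    ((1 - X ^ (2 * n)) * (evenProd g n * (oddProd g n)⁻¹)) with hγ
  set δ : ℕ → ℚ⟦X⟧ := fun n => (-1) ^ n *
    X ^ (2 * (j + s + 1 + 1) * n * (n + (g + 1)) + (2 * j * n + n + 2 * (g + 1) * j + 2 * g + 1)) *
    (evenProd (g + 1) n * (oddProd g (n + 1))⁻¹) with hδ
  have h1 : ∀ n, andrewsTerm g (j + 1) s n = andrewsTerm g j (s + 1) n + (γ n + δ n) := by
    intro n
    have e1 := one_add_X_pow_mul_inv_oddProd g n
    have e2 := one_add_X_pow_mul_inv_oddProd' g n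
    simp only [hγ, hδ, andrewsTerm]
    rw [← e1, ← e2, evenProd_succ]
    ring
  have h2 : ∀ n, X ^ (2 * (g + 1) * j + 2 * g + 1) *
      (X * andrewsTerm (g + 1) s (j + 1) n + andrewsTerm (g + 1) (s + 1) j n) =
      γ (n + 1) + δ n := by
    intro n
    have e1 := one_add_X_pow_mul_inv_oddProd (g + 1) n
    have e2 := one_add_X_pow_mul_inv_oddProd' g n
    simp only [hγ, hδ, andrewsTerm]
    rw [← e2, ← e1, evenProd_succ' g n]
    ring
  have hγs : Summable γ := summable_of_X_pow_dvd fun n => by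
    refine Dvd.dvd.mul_right (Dvd.dvd.mul_left (pow_dvd_pow X ?_) _) _
    rw [add_assoc]
    exact le_andrews_exponent _ _ _ _
  have hδs : Summable δ := summable_of_X_pow_dvd fun n => by
    refine Dvd.dvd.mul_right (Dvd.dvd.mul_left (pow_dvd_pow X ?_) _) _
    exact le_andrews_exponent _ _ _ _
  have hγ0 : γ 0 = 0 := by simp [hγ]
  unfold andrewsSum
  have hA := (summable_andrewsTerm (g + 1) s (j + 1)).mul_left (X : ℚ⟦X⟧)
  have hB := summable_andrewsTerm (g + 1) (s + 1) j
  rw [← (summable_andrewsTerm _ _ _).tsum_mul_left (X : ℚ⟦X⟧), ← hA.tsum_add hB,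
    ← (hA.add hB).tsum_mul_left, tsum_congr h1, tsum_congr h2,
    (summable_andrewsTerm _ _ _).tsum_add (hγs.add hδs), hγs.tsum_add hδs,
    ((summable_nat_add_iff 1).mpr hγs).tsum_add hδs, tsum_nat_add_one hγs hγ0]


/-! ### The `q`-binomial theorem -/

section GaussBinom

variable {R : Type*} [CommRing R]

/-- The Gaussian binomial coefficient with base `p`. -/
def gaussBinom (p : R) : ℕ → ℕ → R
  | _, 0 => 1
  | 0, _ + 1 => 0
  | n + 1, k + 1 => gaussBinom p n k + p ^ (k + 1) * gaussBinom p n (k + 1)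

theorem gaussBinom_zero_right (p : R) (n : ℕ) : gaussBinom p n 0 = 1 := by
  cases n <;> rfl

theorem gaussBinom_eq_zero_of_lt (p : R) : ∀ {n k : ℕ}, n < k → gaussBinom p n k = 0
  | 0, 0, h => absurd h (lt_irrefl 0)
  | 0, _ + 1, _ => rfl
  | n + 1, 0, h => absurd h (by omega)
  | n + 1, k + 1, h => by
    rw [gaussBinom, gaussBinom_eq_zero_of_lt p (by omega : n < k),
      gaussBinom_eq_zero_of_lt p (by omega : n < k + 1)]
    ring

/-- Splitting off the factor `k = 0` replaces `z` by `z * w ^ 2` in the others, and the Pascal rule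
recombines the coefficients. The homogeneous variable `y` avoids negative powers in the later
specialization. -/
theorem prod_add_mul_pow_odd (w y : R) (M : ℕ) : ∀ z : R,
    ∏ k ∈ Finset.range M, (y + z * w ^ (2 * k + 1)) =
      ∑ j ∈ Finset.range (M + 1), w ^ j ^ 2 * gaussBinom (w ^ 2) M j * z ^ j * y ^ (M - j) := by
  induction M with
  | zero => intro z; simp [gaussBinom]
  | succ M ih =>
    intro z
    have h1 : ∏ k ∈ Finset.range M, (y + z * w ^ (2 * (k + 1) + 1)) =
        ∏ k ∈ Finset.range M, (y + (z * w ^ 2) * w ^ (2 * k + 1)) :=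
      Finset.prod_congr rfl fun k _ => by ring
    set a : ℕ → R := fun j =>
      w ^ (j ^ 2 + 2 * j) * gaussBinom (w ^ 2) M j * z ^ j * y ^ (M + 1 - j) with ha
    have h2 : ∀ j ∈ Finset.range (M + 1),
        (w ^ j ^ 2 * gaussBinom (w ^ 2) M j * (z * w ^ 2) ^ j * y ^ (M - j)) * (y + z * w) =
        a j + w ^ (j + 1) ^ 2 * gaussBinom (w ^ 2) M j * z ^ (j + 1) * y ^ (M - j) := by
      intro j hj
      have hj' : j ≤ M := by simpa [Nat.lt_succ_iff] using hj
      simp only [ha]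
      rw [show M + 1 - j = (M - j) + 1 by omega]
      ring
    -- The extra term `a (M + 1)` vanishes because its Gaussian binomial does.
    have h3 : ∑ j ∈ Finset.range (M + 1), a j = ∑ j ∈ Finset.range (M + 1), a (j + 1) + a 0 := by
      rw [← Finset.sum_range_succ', Finset.sum_range_succ (n := M + 1)]
      simp [ha, gaussBinom_eq_zero_of_lt _ (Nat.lt_succ_self M)]
    rw [Finset.prod_range_succ', h1, ih, mul_zero, zero_add, pow_one, Finset.sum_mul,
      Finset.sum_congr rfl h2, Finset.sum_add_distrib, h3, Finset.sum_range_succ' (n := M + 1),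
      add_right_comm, ← Finset.sum_add_distrib]
    congr 1
    · refine Finset.sum_congr rfl fun j _ => ?_
      simp only [ha, gaussBinom]
      rw [show M + 1 - (j + 1) = M - j by omega]
      ring
    · simp [ha, gaussBinom_zero_right]

/-- The `q`-factorial `∏_{k ≤ n} (1 - p ^ k)`. -/
def qFactorial (p : R) (n : ℕ) : R := ∏ k ∈ Finset.range n, (1 - p ^ (k + 1))

theorem qFactorial_succ (p : R) (n : ℕ) :
    qFactorial p (n + 1) = qFactorial p n * (1 - p ^ (n + 1)) :=
  Finset.prod_range_succ _ _

/-- Division-free form of the quotient formula for Gaussian binomials, proved from the Pascal rule.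
-/
theorem qFactorial_mul_gaussBinom (p : R) (n : ℕ) : ∀ i j, i + j = n →
    qFactorial p i * qFactorial p j * gaussBinom p n j = qFactorial p n := by
  induction n with
  | zero =>
    intro i j h
    obtain ⟨rfl, rfl⟩ : i = 0 ∧ j = 0 := by omega
    simp [gaussBinom, qFactorial]
  | succ n ih =>
    intro i j h
    rcases j with _ | j
    · obtain rfl : i = n + 1 := by omega
      simp [gaussBinom, qFactorial]
    · rcases i with _ | i
      · obtain rfl : j = n := by omega
        have := ih 0 j (by omega)
        rw [gaussBinom, gaussBinom_eq_zero_of_lt p (Nat.lt_succ_self j), qFactorial_succ]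
        linear_combination (1 - p ^ (j + 1)) * this
      · have h1 := ih (i + 1) j (by omega)
        have h2 := ih i (j + 1) (by omega)
        obtain rfl : n = i + j + 1 := by omega
        rw [gaussBinom, qFactorial_succ p (i + j + 1)]
        rw [qFactorial_succ] at h1 h2 ⊢
        rw [qFactorial_succ p j]
        linear_combination (1 - p ^ (j + 1)) * h1 + p ^ (j + 1) * (1 - p ^ (i + 1)) * h2

end GaussBinom

/-! ### Jacobi's triple product -/

theorem prod_X_pow_odd (a b N : ℕ) :
    ∏ k ∈ Finset.range N, (-X ^ (b + a * (2 * k + 1)) : ℚ⟦X⟧) =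
      (-1) ^ N * X ^ (b * N + a * N ^ 2) := by
  induction N with
  | zero => simp
  | succ N ih => rw [Finset.prod_range_succ, ih]; ring

theorem jacobi_finite (b c N : ℕ) :
    (∏ k ∈ Finset.range N, ((1 : ℚ⟦X⟧) - X ^ (2 * (b + c) * k + (b + c) + b))) *
      ∏ k ∈ Finset.range N, ((1 : ℚ⟦X⟧) - X ^ (2 * (b + c) * k + c)) =
    ∑ n ∈ Finset.range (N + 1), (-1) ^ n * X ^ ((b + c) * n ^ 2 + b * n) *
        gaussBinom (X ^ (2 * (b + c))) (2 * N) (N + n) -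
      ∑ n ∈ Finset.range N, (-1) ^ n * X ^ ((b + c) * n ^ 2 + (b + c + c) * n + c) *
        gaussBinom (X ^ (2 * (b + c))) (2 * N) (N - 1 - n) := by
  -- The `q`-binomial theorem with `2N` factors, centred by `y = q^(2(b+c)N)` in place of negative
  -- powers of `q`. The lower `N` factors, reversed, yield the exponents `2(b+c)k + c`, the upper
  -- ones `2(b+c)k + (b+c) + b`. In the sum, the indices `N + n` and `N - 1 - n` yield the two
  -- series. Both sides share the factor `(-1)^N q^(bN + 3(b+c)N²)`, cancelled at the end.
  have key := prod_add_mul_pow_odd (X ^ (b + c) : ℚ⟦X⟧) (X ^ (2 * (b + c) * N)) (2 * N) (-X ^ b)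
  rw [← pow_mul, mul_comm (b + c) 2] at key
  have hA : ∏ k ∈ Finset.range N,
      ((X : ℚ⟦X⟧) ^ (2 * (b + c) * N) + -X ^ b * (X ^ (b + c)) ^ (2 * k + 1)) =
      (-1) ^ N * X ^ (b * N + (b + c) * N ^ 2) *
        ∏ k ∈ Finset.range N, (1 - X ^ (2 * (b + c) * k + c)) := by
    rw [← prod_X_pow_odd, ← Finset.prod_range_reflect
      (fun k => (1 : ℚ⟦X⟧) - X ^ (2 * (b + c) * k + c)), ← Finset.prod_mul_distrib]
    refine Finset.prod_congr rfl fun k hk => ?_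
    obtain ⟨t, rfl⟩ : ∃ t, N = t + k + 1 := ⟨N - k - 1, by have := Finset.mem_range.mp hk; omega⟩
    rw [show t + k + 1 - 1 - k = t by omega]
    ring
  have hB : ∏ k ∈ Finset.range N,
      ((X : ℚ⟦X⟧) ^ (2 * (b + c) * N) + -X ^ b * (X ^ (b + c)) ^ (2 * (N + k) + 1)) =
      X ^ (2 * (b + c) * N ^ 2) *
        ∏ k ∈ Finset.range N, (1 - X ^ (2 * (b + c) * k + (b + c) + b)) := by
    have : (X : ℚ⟦X⟧) ^ (2 * (b + c) * N ^ 2) =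
        ∏ k ∈ Finset.range N, (X : ℚ⟦X⟧) ^ (2 * (b + c) * N) := by
      rw [Finset.prod_const, Finset.card_range]; ring
    rw [this, ← Finset.prod_mul_distrib]
    exact Finset.prod_congr rfl fun k hk => by ring
  have hC : ∀ n ∈ Finset.range (N + 1), ((X : ℚ⟦X⟧) ^ (b + c)) ^ (N + n) ^ 2 *
      gaussBinom (X ^ (2 * (b + c))) (2 * N) (N + n) * (-X ^ b) ^ (N + n) *
        (X ^ (2 * (b + c) * N)) ^ (2 * N - (N + n)) =
      (-1) ^ N * X ^ (b * N + 3 * (b + c) * N ^ 2) *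
        ((-1) ^ n * X ^ ((b + c) * n ^ 2 + b * n) *
        gaussBinom (X ^ (2 * (b + c))) (2 * N) (N + n)) := by
    intro n hn
    generalize gaussBinom ((X : ℚ⟦X⟧) ^ (2 * (b + c))) (2 * N) (N + n) = G
    obtain ⟨t, rfl⟩ : ∃ t, N = t + n := ⟨N - n, by have := Finset.mem_range.mp hn; omega⟩
    rw [show 2 * (t + n) - (t + n + n) = t by omega, neg_pow (X ^ b)]
    ring
  have hD : ∀ n ∈ Finset.range N, ((X : ℚ⟦X⟧) ^ (b + c)) ^ (N - 1 - n) ^ 2 *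
      gaussBinom (X ^ (2 * (b + c))) (2 * N) (N - 1 - n) * (-X ^ b) ^ (N - 1 - n) *
        (X ^ (2 * (b + c) * N)) ^ (2 * N - (N - 1 - n)) =
      (-1) ^ N * X ^ (b * N + 3 * (b + c) * N ^ 2) *
        (-((-1) ^ n * X ^ ((b + c) * n ^ 2 + (b + c + c) * n + c) *
        gaussBinom (X ^ (2 * (b + c))) (2 * N) (N - 1 - n))) := by
    intro n hn
    generalize gaussBinom ((X : ℚ⟦X⟧) ^ (2 * (b + c))) (2 * N) (N - 1 - n) = G
    obtain ⟨t, rfl⟩ : ∃ t, N = t + n + 1 := ⟨N - n - 1, by have := Finset.mem_range.mp hn; omega⟩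
    rw [show t + n + 1 - 1 - n = t by omega,
      show 2 * (t + n + 1) - t = t + 2 * n + 2 by omega, neg_pow (X ^ b)]
    have hsq : ((-1 : ℚ⟦X⟧) ^ n) ^ 2 = 1 := by rw [← pow_mul, mul_comm, pow_mul]; simp
    linear_combination (-(-1) ^ t * X ^ ((b + c) * t ^ 2 + b * t +
      2 * (b + c) * (t + n + 1) * (t + 2 * n + 2)) * G) * hsq
  rw [two_mul N, Finset.prod_range_add, ← two_mul, hA, hB, two_mul N, add_assoc,
    Finset.sum_range_add, ← two_mul, Finset.sum_congr rfl hC,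
    ← Finset.sum_range_reflect, Finset.sum_congr rfl hD, ← Finset.mul_sum, ← Finset.mul_sum,
    ← mul_add, Finset.sum_neg_distrib] at key
  have hne : ((-1) ^ N * X ^ (b * N + 3 * (b + c) * N ^ 2) : ℚ⟦X⟧) ≠ 0 :=
    mul_ne_zero (pow_ne_zero _ (neg_ne_zero.mpr one_ne_zero)) (pow_ne_zero _ X_ne_zero)
  apply mul_left_cancel₀ hne
  linear_combination key

/-- The infinite product is `qFactorial n` times a tail that is `1` modulo `q^(a(n+1))`. Inserting
this for `n = i`, `j`, `i + j` in the quotient formula leaves only tails. -/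
theorem X_pow_dvd_prod_mul_gaussBinom_sub_one {a : ℕ} (ha : 0 < a) {i j K : ℕ} (hi : K ≤ i)
    (hj : K ≤ j) :
    X ^ (a * (K + 1)) ∣ (∏' k : ℕ, ((1 : ℚ⟦X⟧) - X ^ (a * (k + 1)))) *
      gaussBinom (X ^ a) (i + j) j - 1 := by
  set Q : ℚ⟦X⟧ := ∏' k : ℕ, ((1 : ℚ⟦X⟧) - X ^ (a * (k + 1))) with hQ
  have hdvd : ∀ n k : ℕ, (X : ℚ⟦X⟧) ^ (a * (n + 1)) ∣ 1 - X ^ (a * (k + n + 1)) - 1 := by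
    intro n k
    rw [sub_sub_cancel_left, dvd_neg]
    exact pow_dvd_pow _ (Nat.mul_le_mul_left _ (by omega))
  have hm : ∀ n : ℕ, Multipliable fun k : ℕ => (1 : ℚ⟦X⟧) - X ^ (a * (k + n + 1)) := by
    refine fun n => multipliable_of_X_pow_dvd_sub_one fun k => ?_
    rw [sub_sub_cancel_left, dvd_neg]
    exact pow_dvd_pow _ (by nlinarith)
  have hfac : ∀ n, ∃ T : ℚ⟦X⟧, Q = qFactorial (X ^ a) n * T ∧ X ^ (a * (n + 1)) ∣ T - 1 := by
    intro n
    refine ⟨_, ?_, X_pow_dvd_tprod_sub_one (hm n) (hdvd n)⟩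
    have := (hm n).prod_mul_tprod_nat_mul' (f := fun k : ℕ => (1 : ℚ⟦X⟧) - X ^ (a * (k + 1)))
    rw [hQ, ← this, qFactorial]
    simp only [pow_mul]
  have hQ0 : Q ≠ 0 := by
    intro h0
    obtain ⟨T, h1, h2⟩ := hfac 0
    have h3 := (X_pow_dvd_iff.mp h2) 0 (by positivity)
    rw [h0] at h1
    simp only [qFactorial, Finset.range_zero, Finset.prod_empty, one_mul] at h1
    rw [← h1] at h3
    simp at h3
  obtain ⟨T₁, h1, d1⟩ := hfac i
  obtain ⟨T₂, h2, d2⟩ := hfac j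
  obtain ⟨T₃, h3, d3⟩ := hfac (i + j)
  have hle : ∀ n, K ≤ n → (X : ℚ⟦X⟧) ^ (a * (K + 1)) ∣ X ^ (a * (n + 1)) := fun n hn =>
    pow_dvd_pow _ (Nat.mul_le_mul_left _ (by omega))
  refine dvd_sub_one_of_mul_eq ((hle _ (by omega)).trans d3)
    (dvd_mul_sub_one ((hle _ hi).trans d1) ((hle _ hj).trans d2)) ?_
  apply mul_left_cancel₀ hQ0
  have hb := qFactorial_mul_gaussBinom ((X : ℚ⟦X⟧) ^ a) (i + j) i j rfl
  calc Q * (T₃ * (Q * gaussBinom (X ^ a) (i + j) j))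
      = T₃ * Q * Q * gaussBinom (X ^ a) (i + j) j := by ring
    _ = T₃ * (qFactorial (X ^ a) i * T₁) * (qFactorial (X ^ a) j * T₂) *
        gaussBinom (X ^ a) (i + j) j := by rw [← h1, ← h2]
    _ = (qFactorial (X ^ a) (i + j) * T₃) * (T₁ * T₂) := by rw [← hb]; ring
    _ = Q * (T₁ * T₂) := by rw [← h3]

theorem X_pow_dvd_mul_of_le {f : ℚ⟦X⟧} {m l k : ℕ} (h : X ^ k ∣ f) (hm : m ≤ l + k) :
    X ^ m ∣ X ^ l * f :=
  (pow_dvd_pow X hm).trans (by rw [pow_add]; exact mul_dvd_mul_left _ h)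

theorem jacobi_triple_product (b c : ℕ) (hc : 0 < c) :
    (∏' k : ℕ, ((1 : ℚ⟦X⟧) - X ^ (2 * (b + c) * (k + 1)))) *
      ((∏' k : ℕ, ((1 : ℚ⟦X⟧) - X ^ (2 * (b + c) * k + (b + c) + b))) *
        ∏' k : ℕ, ((1 : ℚ⟦X⟧) - X ^ (2 * (b + c) * k + c))) =
    ∑' n : ℕ, (-1) ^ n * ((X : ℚ⟦X⟧) ^ ((b + c) * n ^ 2 + b * n) -
      X ^ ((b + c) * n ^ 2 + (b + c + c) * n + c)) := by
  set Q : ℚ⟦X⟧ := ∏' k : ℕ, ((1 : ℚ⟦X⟧) - X ^ (2 * (b + c) * (k + 1))) with hQ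
  have hm : ∀ f : ℕ → ℕ, (∀ k, k ≤ f k) → Multipliable fun k : ℕ => (1 : ℚ⟦X⟧) - X ^ f k :=
    fun f hf => multipliable_of_X_pow_dvd_sub_one fun k => by
      rw [sub_sub_cancel_left, dvd_neg]
      exact pow_dvd_pow _ (hf k)
  have hsq : ∀ n : ℕ, n ≤ (b + c) * n ^ 2 := fun n => by
    rcases Nat.eq_zero_or_pos n with rfl | h
    · simp
    · have : 1 * n ≤ ((b + c) * n) * n := Nat.mul_le_mul_right n (by nlinarith)
      nlinarith
  have hlim := (((hm (fun k => 2 * (b + c) * k + (b + c) + b)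
    fun k => by nlinarith).tendsto_prod_tprod_nat).mul
    ((hm (fun k => 2 * (b + c) * k + c) fun k => by nlinarith).tendsto_prod_tprod_nat)).const_mul Q
  have hsum : Summable fun n : ℕ => (-1) ^ n * ((X : ℚ⟦X⟧) ^ ((b + c) * n ^ 2 + b * n) -
      X ^ ((b + c) * n ^ 2 + (b + c + c) * n + c)) :=
    summable_of_X_pow_dvd fun n => Dvd.dvd.mul_left (dvd_sub
      (pow_dvd_pow _ (by linarith [hsq n, Nat.zero_le (b * n)]))
      (pow_dvd_pow _ (by linarith [hsq n, Nat.zero_le ((b + c + c) * n)]))) _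
  refine tendsto_nhds_unique hlim ?_
  have hdiff : Tendsto (fun N => Q * ((∏ k ∈ Finset.range N,
      ((1 : ℚ⟦X⟧) - X ^ (2 * (b + c) * k + (b + c) + b))) *
      ∏ k ∈ Finset.range N, ((1 : ℚ⟦X⟧) - X ^ (2 * (b + c) * k + c))) -
      ∑ n ∈ Finset.range N, (-1) ^ n * ((X : ℚ⟦X⟧) ^ ((b + c) * n ^ 2 + b * n) -
      X ^ ((b + c) * n ^ 2 + (b + c + c) * n + c))) atTop (𝓝 0) := by
    refine tendsto_of_X_pow_dvd_sub fun N => ?_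
    rw [sub_zero, jacobi_finite, Finset.sum_range_succ]
    have : Q * (∑ n ∈ Finset.range N, (-1) ^ n * X ^ ((b + c) * n ^ 2 + b * n) *
        gaussBinom (X ^ (2 * (b + c))) (2 * N) (N + n) +
        (-1) ^ N * X ^ ((b + c) * N ^ 2 + b * N) *
        gaussBinom (X ^ (2 * (b + c))) (2 * N) (N + N) -
      ∑ n ∈ Finset.range N, (-1) ^ n * X ^ ((b + c) * n ^ 2 + (b + c + c) * n + c) *
        gaussBinom (X ^ (2 * (b + c))) (2 * N) (N - 1 - n)) -
      ∑ n ∈ Finset.range N, (-1) ^ n * ((X : ℚ⟦X⟧) ^ ((b + c) * n ^ 2 + b * n) -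
      X ^ ((b + c) * n ^ 2 + (b + c + c) * n + c)) =
      ∑ n ∈ Finset.range N, (-1) ^ n * (X ^ ((b + c) * n ^ 2 + b * n) *
        (Q * gaussBinom (X ^ (2 * (b + c))) (2 * N) (N + n) - 1) -
        X ^ ((b + c) * n ^ 2 + (b + c + c) * n + c) *
        (Q * gaussBinom (X ^ (2 * (b + c))) (2 * N) (N - 1 - n) - 1)) +
      X ^ ((b + c) * N ^ 2 + b * N) *
        (Q * (-1) ^ N * gaussBinom (X ^ (2 * (b + c))) (2 * N) (N + N)) := by
      rw [mul_sub, mul_add, Finset.mul_sum, Finset.mul_sum, add_sub_right_comm,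
        ← Finset.sum_sub_distrib, add_sub_right_comm, ← Finset.sum_sub_distrib]
      congr 1
      · exact Finset.sum_congr rfl fun n _ => by ring
      · ring
    rw [this]
    refine dvd_add (Finset.dvd_sum fun n hn => Dvd.dvd.mul_left (dvd_sub ?_ ?_) _)
      (Dvd.dvd.mul_right (pow_dvd_pow _ (by linarith [hsq N, Nat.zero_le (b * N)])) _)
    -- The binomial error contributes `q^(2(b+c)(t+1))` with `t = N - n`, and its coefficient
    -- contributes `q^((b+c)n² + bn)`; together at least `q^N`.
    · obtain ⟨t, rfl⟩ : ∃ t, N = t + n := ⟨N - n, by have := Finset.mem_range.mp hn; omega⟩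
      have h := X_pow_dvd_prod_mul_gaussBinom_sub_one (a := 2 * (b + c)) (by omega)
        (i := t) (j := t + n + n) (K := t) le_rfl (by omega)
      rw [show t + (t + n + n) = 2 * (t + n) by ring] at h
      refine X_pow_dvd_mul_of_le h ?_
      nlinarith [hsq n, Nat.zero_le (b * n)]
    · obtain ⟨t, rfl⟩ : ∃ t, N = t + n + 1 := ⟨N - n - 1, by have := Finset.mem_range.mp hn; omega⟩
      have h := X_pow_dvd_prod_mul_gaussBinom_sub_one (a := 2 * (b + c)) (by omega)
        (i := t + n + n + 2) (j := t) (K := t) (by omega) le_rfl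
      rw [show t + n + n + 2 + t = 2 * (t + n + 1) by ring] at h
      rw [show t + n + 1 - 1 - n = t by omega]
      refine X_pow_dvd_mul_of_le h ?_
      nlinarith [hsq n, Nat.zero_le ((b + c + c) * n)]
  have := hdiff.add hsum.tendsto_sum_tsum_nat
  simpa using this


/-! ### Infinite products -/

theorem multipliable_one_sub_X_pow {f : ℕ → ℕ} (hf : ∀ k, k ≤ f k) :
    Multipliable fun k : ℕ => (1 : ℚ⟦X⟧) - X ^ f k :=
  multipliable_of_X_pow_dvd_sub_one fun k => by
    rw [sub_sub_cancel_left, dvd_neg]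
    exact pow_dvd_pow _ (hf k)

theorem multipliable_one_add_X_pow {f : ℕ → ℕ} (hf : ∀ k, k ≤ f k) :
    Multipliable fun k : ℕ => (1 : ℚ⟦X⟧) + X ^ f k :=
  multipliable_of_X_pow_dvd_sub_one fun k => by
    rw [add_sub_cancel_left]
    exact pow_dvd_pow _ (hf k)

theorem multipliable_ite_one_sub_X_pow (p : ℕ → Prop) [DecidablePred p] :
    Multipliable fun m : ℕ => if p m then (1 : ℚ⟦X⟧) - X ^ m else 1 :=
  multipliable_of_X_pow_dvd_sub_one fun k => by
    split_ifs
    · rw [sub_sub_cancel_left, dvd_neg]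
    · simp

theorem tprod_ite_one_sub_X_pow {p : ℕ → Prop} [DecidablePred p] {f : ℕ → ℕ}
    (hf : Function.Injective f) (hp : ∀ m, p m ↔ ∃ k, f k = m) :
    ∏' m : ℕ, (if p m then (1 : ℚ⟦X⟧) - X ^ m else 1) = ∏' k : ℕ, ((1 : ℚ⟦X⟧) - X ^ f k) := by
  rw [← hf.tprod_eq]
  · exact tprod_congr fun k => if_pos ((hp _).mpr ⟨k, rfl⟩)
  · intro m hm
    by_contra h
    exact hm (if_neg fun hpm => h ((hp m).mp hpm))

/-- The second product runs over odd `m` and multiples of `4`. Pairing `1 + q^m` with `1 - q^m` for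
odd `m` gives the factors with exponent `2` modulo `4`. -/
theorem prod_odd_mul_prod_not_two_mod_four :
    (∏' k : ℕ, ((1 : ℚ⟦X⟧) + X ^ (2 * k + 1))) *
      ∏' m : ℕ, (if 1 ≤ m ∧ ¬ m ≡ 2 [MOD 4] then (1 : ℚ⟦X⟧) - X ^ m else 1) =
    ∏' k : ℕ, ((1 : ℚ⟦X⟧) - X ^ (2 * k + 2)) := by
  have h1 : ∏' m : ℕ, (if 1 ≤ m ∧ ¬ m ≡ 2 [MOD 4] then (1 : ℚ⟦X⟧) - X ^ m else 1) =
      (∏' k : ℕ, ((1 : ℚ⟦X⟧) - X ^ (2 * k + 1))) * ∏' k : ℕ, ((1 : ℚ⟦X⟧) - X ^ (4 * k + 4)) := by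
    rw [← tprod_ite_one_sub_X_pow (p := fun m => m % 2 = 1) (f := fun k => 2 * k + 1)
        (fun a b h => by simpa using h) (fun m => ⟨fun h => ⟨m / 2, by omega⟩, by rintro ⟨k, rfl⟩; omega⟩),
      ← tprod_ite_one_sub_X_pow (p := fun m => 1 ≤ m ∧ m % 4 = 0) (f := fun k => 4 * k + 4)
        (fun a b h => by simpa using h)
        (fun m => ⟨fun h => ⟨m / 4 - 1, by omega⟩, by rintro ⟨k, rfl⟩; omega⟩),
      ← (multipliable_ite_one_sub_X_pow _).tprod_mul (multipliable_ite_one_sub_X_pow _)]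
    refine tprod_congr fun m => ?_
    unfold Nat.ModEq
    by_cases h1 : m % 2 = 1
    · rw [if_pos (by omega), if_pos h1, if_neg (by omega), mul_one]
    · by_cases h2 : 1 ≤ m ∧ m % 4 = 0
      · rw [if_pos (by omega), if_neg h1, if_pos h2, one_mul]
      · rw [if_neg (by omega), if_neg h1, if_neg h2, one_mul]
  have h2 := tprod_even_mul_odd (f := fun k : ℕ => (1 : ℚ⟦X⟧) - X ^ (2 * k + 2))
    (multipliable_one_sub_X_pow fun k => by omega) (multipliable_one_sub_X_pow fun k => by omega)
  rw [h1, ← mul_assoc, ← (multipliable_one_add_X_pow fun k => by omega).tprod_mul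
    (multipliable_one_sub_X_pow fun k => by omega), ← h2]
  exact congrArg₂ _ (tprod_congr fun k => by ring) (tprod_congr fun k => by ring)

theorem int_modEq_sub_iff {m b c : ℕ} (hb : 0 < b) :
    ((m : ℤ) ≡ (b + c) - b [ZMOD 2 * (b + c)]) ↔ ∃ k : ℕ, 2 * (b + c) * k + c = m := by
  rw [add_sub_cancel_left]
  constructor
  · intro h
    have h' : m ≡ c [MOD 2 * (b + c)] := by
      rw [← Int.natCast_modEq_iff]; push_cast; exact h
    have hc : c % (2 * (b + c)) = c := Nat.mod_eq_of_lt (by omega)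
    unfold Nat.ModEq at h'
    rw [hc] at h'
    refine ⟨m / (2 * (b + c)), ?_⟩
    have := Nat.div_add_mod m (2 * (b + c))
    rwa [h'] at this
  · rintro ⟨k, rfl⟩
    push_cast
    exact (Int.modEq_iff_dvd.mpr ⟨-k, by ring⟩)

theorem int_modEq_add_iff {m b c : ℕ} (hc : 0 < c) :
    ((m : ℤ) ≡ (b + c) + b [ZMOD 2 * (b + c)]) ↔ ∃ k : ℕ, 2 * (b + c) * k + (b + c) + b = m := by
  constructor
  · intro h
    have h' : m ≡ b + c + b [MOD 2 * (b + c)] := by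
      rw [← Int.natCast_modEq_iff]; push_cast; exact h
    have hc : (b + c + b) % (2 * (b + c)) = b + c + b := Nat.mod_eq_of_lt (by omega)
    unfold Nat.ModEq at h'
    rw [hc] at h'
    refine ⟨m / (2 * (b + c)), ?_⟩
    have := Nat.div_add_mod m (2 * (b + c))
    rw [h'] at this
    omega
  · rintro ⟨k, rfl⟩
    push_cast
    exact (Int.modEq_iff_dvd.mpr ⟨-k, by ring⟩)

theorem nat_modEq_zero_iff {m a : ℕ} (ha : 0 < a) :
    (1 ≤ m ∧ m ≡ 0 [MOD a]) ↔ ∃ k : ℕ, a * (k + 1) = m := by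
  rw [Nat.modEq_zero_iff_dvd]
  constructor
  · rintro ⟨h, k, rfl⟩
    rcases k with _ | k
    · simp at h
    · exact ⟨k, rfl⟩
  · rintro ⟨k, rfl⟩
    exact ⟨Nat.mul_pos ha k.succ_pos, dvd_mul_right _ _⟩

/-- The contribution of a single `m` to `productSeries_mul`: an allowed `m` contributes `1`, and an
`m` in one of the three disjoint excluded classes leaves its factor uncancelled. -/
theorem ite_mul_ite_eq {R : Type*} [CommRing R] {x y : R} {h t p₀ p₁ p₂ q₀ q₁ q₂ : Prop}
    [Decidable h] [Decidable t] [Decidable p₀] [Decidable p₁] [Decidable p₂] [Decidable q₀]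
    [Decidable q₁] [Decidable q₂] (e₀ : p₀ ↔ q₀) (e₁ : p₁ ↔ q₁) (e₂ : p₂ ↔ q₂)
    (h₀ : q₀ → ¬ t) (h₁ : q₁ → ¬ t) (h₂ : q₂ → ¬ t) (h₀₁ : q₀ → ¬ q₁) (h₀₂ : q₀ → ¬ q₂)
    (h₁₂ : q₁ → ¬ q₂) (k₁ : q₁ → h) (k₂ : q₂ → h) (hxy : h → y * x = 1) :
    (if h ∧ ¬ t ∧ ¬ p₀ ∧ ¬ p₁ ∧ ¬ p₂ then y else 1) * (if h ∧ ¬ t then x else 1) =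
      (if h ∧ q₀ then x else 1) * ((if q₁ then x else 1) * if q₂ then x else 1) := by
  by_cases c : h
  · by_cases c₀ : q₀
    · simp [e₀, e₁, e₂, c, c₀, h₀ c₀, h₀₁ c₀, h₀₂ c₀]
    · by_cases c₁ : q₁
      · simp [e₀, e₁, e₂, c, c₀, c₁, h₁ c₁, h₁₂ c₁]
      · by_cases c₂ : q₂
        · simp [e₀, e₁, e₂, c, c₀, c₁, c₂, h₂ c₂]
        · by_cases ct : t
          · simp [c₀, c₁, c₂, ct]
          · simp [e₀, e₁, e₂, c, c₀, c₁, c₂, ct, hxy c]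
  · have c₁ : ¬ q₁ := fun h' => c (k₁ h')
    have c₂ : ¬ q₂ := fun h' => c (k₂ h')
    simp [c, c₁, c₂]

/-- The excluded residues modulo `4r` match the triple product with `b = 2s + 1`, `c = 2j + 1`,
where `b + c = 2r`. They are odd or divisible by `4`, so none of them is already removed by the
condition modulo `4`. -/
theorem productSeries_mul (j s : ℕ) :
    productSeries (j + s + 1) (s + 1) *
      ∏' m : ℕ, (if 1 ≤ m ∧ ¬ m ≡ 2 [MOD 4] then (1 : ℚ⟦X⟧) - X ^ m else 1) =
    (∏' k : ℕ, ((1 : ℚ⟦X⟧) - X ^ (2 * ((2 * s + 1) + (2 * j + 1)) * (k + 1)))) *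
      ((∏' k : ℕ, ((1 : ℚ⟦X⟧) - X ^ (2 * ((2 * s + 1) + (2 * j + 1)) * k +
        ((2 * s + 1) + (2 * j + 1)) + (2 * s + 1)))) *
        ∏' k : ℕ, ((1 : ℚ⟦X⟧) - X ^ (2 * ((2 * s + 1) + (2 * j + 1)) * k + (2 * j + 1)))) := by
  classical
  have hpos : 0 < 2 * ((2 * s + 1) + (2 * j + 1)) := by omega
  rw [← tprod_ite_one_sub_X_pow (f := fun k => 2 * ((2 * s + 1) + (2 * j + 1)) * (k + 1))
      (fun a b h => by simpa using h) (fun m => nat_modEq_zero_iff hpos),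
    ← tprod_ite_one_sub_X_pow (f := fun k => 2 * ((2 * s + 1) + (2 * j + 1)) * k +
        ((2 * s + 1) + (2 * j + 1)) + (2 * s + 1))
      (fun a b h => by simpa using h) (fun m => int_modEq_add_iff (by omega)),
    ← tprod_ite_one_sub_X_pow (f := fun k => 2 * ((2 * s + 1) + (2 * j + 1)) * k + (2 * j + 1))
      (fun a b h => by simpa using h) (fun m => int_modEq_sub_iff (by omega)),
    ← (multipliable_ite_one_sub_X_pow _).tprod_mul (multipliable_ite_one_sub_X_pow _),
    ← (multipliable_ite_one_sub_X_pow _).tprod_mul ((multipliable_ite_one_sub_X_pow _).mul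
      (multipliable_ite_one_sub_X_pow _)), productSeries,
    ← (multipliable_productSeries _).tprod_mul (multipliable_ite_one_sub_X_pow _)]
  refine tprod_congr fun m => ?_
  have hZ : 1 ≤ m → (1 - X ^ m : ℚ⟦X⟧)⁻¹ * (1 - X ^ m) = 1 := fun h =>
    PowerSeries.inv_mul_cancel _ (by
      have : m ≠ 0 := by omega
      simp [this])
  have e0 : m ≡ 0 [MOD 4 * (j + s + 1)] ↔ m ≡ 0 [MOD 2 * ((2 * s + 1) + (2 * j + 1))] := by
    rw [show 4 * (j + s + 1) = 2 * ((2 * s + 1) + (2 * j + 1)) by ring]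
  have e1 : ((m : ℤ) ≡ 2 * ((j + s + 1 : ℕ) : ℤ) + (2 * ((s + 1 : ℕ) : ℤ) - 1)
      [ZMOD 4 * ((j + s + 1 : ℕ) : ℤ)]) ↔ ((m : ℤ) ≡ ((2 * s + 1 : ℕ) + (2 * j + 1 : ℕ) : ℤ) + (2 * s + 1 : ℕ)
      [ZMOD 2 * ((2 * s + 1 : ℕ) + (2 * j + 1 : ℕ))]) := by
    rw [show (4 * ((j + s + 1 : ℕ) : ℤ)) = 2 * ((2 * s + 1 : ℕ) + (2 * j + 1 : ℕ)) by push_cast; ring,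
      show (2 * ((j + s + 1 : ℕ) : ℤ) + (2 * ((s + 1 : ℕ) : ℤ) - 1)) =
        ((2 * s + 1 : ℕ) + (2 * j + 1 : ℕ) : ℤ) + (2 * s + 1 : ℕ) by push_cast; ring]
  have e2 : ((m : ℤ) ≡ 2 * ((j + s + 1 : ℕ) : ℤ) - (2 * ((s + 1 : ℕ) : ℤ) - 1)
      [ZMOD 4 * ((j + s + 1 : ℕ) : ℤ)]) ↔ ((m : ℤ) ≡ ((2 * s + 1 : ℕ) + (2 * j + 1 : ℕ) : ℤ) - (2 * s + 1 : ℕ)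
      [ZMOD 2 * ((2 * s + 1 : ℕ) + (2 * j + 1 : ℕ))]) := by
    rw [show (4 * ((j + s + 1 : ℕ) : ℤ)) = 2 * ((2 * s + 1 : ℕ) + (2 * j + 1 : ℕ)) by push_cast; ring,
      show (2 * ((j + s + 1 : ℕ) : ℤ) - (2 * ((s + 1 : ℕ) : ℤ) - 1)) =
        ((2 * s + 1 : ℕ) + (2 * j + 1 : ℕ) : ℤ) - (2 * s + 1 : ℕ) by push_cast; ring]
  have d0 : m ≡ 0 [MOD 2 * ((2 * s + 1) + (2 * j + 1))] → m % 4 = 0 := by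
    intro h
    rw [Nat.modEq_zero_iff_dvd] at h
    obtain ⟨k, rfl⟩ := h
    rw [show 2 * (2 * s + 1 + (2 * j + 1)) * k = 4 * ((s + j + 1) * k) by ring]
    omega
  have d1 := int_modEq_add_iff (m := m) (b := 2 * s + 1) (c := 2 * j + 1) (by omega)
  have d2 := int_modEq_sub_iff (m := m) (b := 2 * s + 1) (c := 2 * j + 1) (by omega)
  have f1 : (∃ k : ℕ, 2 * (2 * s + 1 + (2 * j + 1)) * k + (2 * s + 1 + (2 * j + 1)) + (2 * s + 1) = m)
      → m % 2 = 1 := by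
    rintro ⟨k, rfl⟩
    rw [mul_assoc]
    omega
  have f2 : (∃ k : ℕ, 2 * (2 * s + 1 + (2 * j + 1)) * k + (2 * j + 1) = m) → m % 2 = 1 := by
    rintro ⟨k, rfl⟩
    rw [mul_assoc]
    omega
  have f3 : (∃ k : ℕ, 2 * (2 * s + 1 + (2 * j + 1)) * k + (2 * s + 1 + (2 * j + 1)) + (2 * s + 1) = m)
      → ¬ (∃ k : ℕ, 2 * (2 * s + 1 + (2 * j + 1)) * k + (2 * j + 1) = m) := by
    rintro ⟨k, rfl⟩ ⟨l, h⟩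
    have : ((2 * (2 * s + 1 + (2 * j + 1))) * l + (2 * j + 1)) % (2 * (2 * s + 1 + (2 * j + 1))) =
      ((2 * (2 * s + 1 + (2 * j + 1))) * k + (2 * s + 1 + (2 * j + 1) + (2 * s + 1))) %
        (2 * (2 * s + 1 + (2 * j + 1))) := by rw [h, add_assoc]
    rw [Nat.mul_add_mod, Nat.mul_add_mod, Nat.mod_eq_of_lt (by omega), Nat.mod_eq_of_lt (by omega)] at this
    omega
  rw [← d1, ← d2] at f3
  rw [← d1] at f1
  rw [← d2] at f2
  refine ite_mul_ite_eq e0 e1 e2 (fun h h' => ?_) (fun h h' => ?_) (fun h h' => ?_)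
    (fun h h' => ?_) (fun h h' => ?_) f3 (fun h => ?_) (fun h => ?_) hZ
  · have := d0 h
    unfold Nat.ModEq at h'
    omega
  · have := f1 h
    unfold Nat.ModEq at h'
    omega
  · have := f2 h
    unfold Nat.ModEq at h'
    omega
  · have := d0 h
    have := f1 h'
    omega
  · have := d0 h
    have := f2 h'
    omega
  · have := f1 h
    omega
  · have := f2 h
    omega

/-! ### The normalized series -/

/-- The normalizing product `∏ (1 + q ^ (2 k + 1)) / ∏ (1 - q ^ (2 k + 2))`. -/
noncomputable def andrewsPrefactor : ℚ⟦X⟧ :=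
  (∏' k : ℕ, ((1 : ℚ⟦X⟧) + X ^ (2 * k + 1))) * (∏' k : ℕ, ((1 : ℚ⟦X⟧) - X ^ (2 * k + 2)))⁻¹

theorem constantCoeff_eq_one_of_dvd {f : ℚ⟦X⟧} (h : X ^ 1 ∣ f - 1) : constantCoeff f = 1 := by
  have := X_pow_dvd_iff.mp h 0 (by norm_num)
  simpa [sub_eq_zero] using this

theorem constantCoeff_prod_even :
    constantCoeff (∏' k : ℕ, ((1 : ℚ⟦X⟧) - X ^ (2 * k + 2))) = 1 := by
  refine constantCoeff_eq_one_of_dvd (X_pow_dvd_tprod_sub_one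
    (multipliable_one_sub_X_pow fun k => by omega) fun n => ?_)
  rw [sub_sub_cancel_left, dvd_neg]
  exact pow_dvd_pow _ (by omega)

theorem andrewsPrefactor_mul :
    andrewsPrefactor *
      ∏' m : ℕ, (if 1 ≤ m ∧ ¬ m ≡ 2 [MOD 4] then (1 : ℚ⟦X⟧) - X ^ m else 1) = 1 := by
  have h := PowerSeries.inv_mul_cancel (∏' k : ℕ, ((1 : ℚ⟦X⟧) - X ^ (2 * k + 2)))
    (by rw [constantCoeff_prod_even]; exact one_ne_zero)
  rw [andrewsPrefactor]
  linear_combination h + (∏' k : ℕ, ((1 : ℚ⟦X⟧) - X ^ (2 * k + 2)))⁻¹ *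
    prod_odd_mul_prod_not_two_mod_four

/-- At `g = 0` the bracket factors as `(1 + y)(1 - y^(2j+1))` with `y = q^(2n+1)`, and `1 + y` is
the whole denominator. -/
theorem andrewsTerm_zero (j s n : ℕ) :
    andrewsTerm 0 j s n =
      (-1) ^ n * ((X : ℚ⟦X⟧) ^ (((2 * s + 1) + (2 * j + 1)) * n ^ 2 + (2 * s + 1) * n) -
      X ^ (((2 * s + 1) + (2 * j + 1)) * n ^ 2 +
        ((2 * s + 1) + (2 * j + 1) + (2 * j + 1)) * n + (2 * j + 1))) := by
  have h := one_add_X_pow_mul_inv_oddProd 0 n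
  have h0 : (oddProd 0 n)⁻¹ = 1 := by
    have := oddProd_mul_inv 0 n
    rwa [show oddProd 0 n = 1 by simp [oddProd], one_mul] at this
  rw [h0] at h
  rw [andrewsTerm, show evenProd 0 n = 1 by simp [evenProd], one_mul]
  linear_combination (-1) ^ n *
    ((X : ℚ⟦X⟧) ^ (((2 * s + 1) + (2 * j + 1)) * n ^ 2 + (2 * s + 1) * n) -
      X ^ (((2 * s + 1) + (2 * j + 1)) * n ^ 2 +
        ((2 * s + 1) + (2 * j + 1) + (2 * j + 1)) * n + (2 * j + 1))) * h

theorem productSeries_eq (j s : ℕ) :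
    productSeries (j + s + 1) (s + 1) = andrewsPrefactor * andrewsSum 0 j s := by
  have h1 := productSeries_mul j s
  rw [jacobi_triple_product _ _ (by omega)] at h1
  rw [andrewsSum, tsum_congr (andrewsTerm_zero j s), ← h1]
  linear_combination -productSeries (j + s + 1) (s + 1) * andrewsPrefactor_mul

theorem X_pow_dvd_andrewsPrefactor_mul (g : ℕ) :
    X ^ g ∣ andrewsPrefactor * (evenProd g 0 * (oddProd (g + 1) 0)⁻¹) - 1 := by
  have hE := Multipliable.prod_mul_tprod_nat_mul'
    (f := fun k : ℕ => (1 : ℚ⟦X⟧) - X ^ (2 * k + 2)) (k := g)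
    (multipliable_one_sub_X_pow fun k => by omega)
  have hO := Multipliable.prod_mul_tprod_nat_mul'
    (f := fun k : ℕ => (1 : ℚ⟦X⟧) + X ^ (2 * k + 1)) (k := g + 1)
    (multipliable_one_add_X_pow fun k => by omega)
  rw [show ∏ i ∈ Finset.range g, ((1 : ℚ⟦X⟧) - X ^ (2 * i + 2)) = evenProd g 0 from
    Finset.prod_congr rfl fun k _ => by ring] at hE
  rw [show ∏ i ∈ Finset.range (g + 1), ((1 : ℚ⟦X⟧) + X ^ (2 * i + 1)) = oddProd (g + 1) 0 from
    Finset.prod_congr rfl fun k _ => by ring] at hO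
  have dE : X ^ g ∣ (∏' k : ℕ, ((1 : ℚ⟦X⟧) - X ^ (2 * (k + g) + 2))) - 1 :=
    X_pow_dvd_tprod_sub_one (multipliable_one_sub_X_pow fun k => by omega) fun n => by
      rw [sub_sub_cancel_left, dvd_neg]
      exact pow_dvd_pow _ (by omega)
  have dO : X ^ g ∣ (∏' k : ℕ, ((1 : ℚ⟦X⟧) + X ^ (2 * (k + (g + 1)) + 1))) - 1 :=
    X_pow_dvd_tprod_sub_one (multipliable_one_add_X_pow fun k => by omega) fun n => by
      rw [add_sub_cancel_left]
      exact pow_dvd_pow _ (by omega)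
  refine dvd_sub_one_of_mul_eq dE dO ?_
  have h := PowerSeries.inv_mul_cancel (∏' k : ℕ, ((1 : ℚ⟦X⟧) - X ^ (2 * k + 2)))
    (by rw [constantCoeff_prod_even]; exact one_ne_zero)
  have h2 := oddProd_mul_inv (g + 1) 0
  rw [andrewsPrefactor]
  generalize ∏' k : ℕ, ((1 : ℚ⟦X⟧) - X ^ (2 * (k + g) + 2)) = E' at *
  generalize ∏' k : ℕ, ((1 : ℚ⟦X⟧) + X ^ (2 * (k + (g + 1)) + 1)) = O' at *
  generalize (∏' k : ℕ, ((1 : ℚ⟦X⟧) - X ^ (2 * k + 2)))⁻¹ = Ei at *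
  rw [← hE] at h
  rw [← hO]
  linear_combination oddProd (g + 1) 0 * O' * (oddProd (g + 1) 0)⁻¹ * h + O' * h2

/-- Andrews' series with its infinite products. -/
noncomputable def andrewsSeries (g j s : ℕ) : ℚ⟦X⟧ := andrewsPrefactor * andrewsSum g j s

/-- In the term `n = 0` the finite products cancel the prefactor up to tails beginning beyond `q^g`.
The terms with `n ≥ 1` carry the exponent `2r n(n+g) ≥ g`. -/
theorem X_pow_dvd_andrewsSeries_sub_one (g j s : ℕ) : X ^ g ∣ andrewsSeries g j s - 1 := by
  have h0 : X ^ g ∣ andrewsPrefactor * andrewsTerm g j s 0 - 1 := by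
    have : andrewsPrefactor * andrewsTerm g j s 0 =
        (andrewsPrefactor * (evenProd g 0 * (oddProd (g + 1) 0)⁻¹)) *
        (1 - X ^ ((j + 1) * (4 * 0 + 2 * g + 2)) +
          X ^ (2 * 0 + 1 + 2 * g) * (1 - X ^ (j * (4 * 0 + 2 * g + 2)))) := by
      rw [andrewsTerm]; ring
    rw [this]
    refine dvd_mul_sub_one (X_pow_dvd_andrewsPrefactor_mul g) ?_
    have h1 : (X : ℚ⟦X⟧) ^ g ∣ X ^ ((j + 1) * (4 * 0 + 2 * g + 2)) :=
      pow_dvd_pow _ (by nlinarith)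
    have h2 : (X : ℚ⟦X⟧) ^ g ∣ X ^ (2 * 0 + 1 + 2 * g) := pow_dvd_pow _ (by omega)
    have := dvd_sub (h2.mul_right (1 - X ^ (j * (4 * 0 + 2 * g + 2)))) h1
    convert this using 1
    ring
  have hs : X ^ g ∣ ∑' n, andrewsTerm g j s (n + 1) :=
    X_pow_dvd_tsum ((summable_nat_add_iff 1).mpr (summable_andrewsTerm g j s)) fun n => by
      unfold andrewsTerm
      refine Dvd.dvd.mul_right (Dvd.dvd.mul_right (Dvd.dvd.mul_left (pow_dvd_pow X ?_) _) _) _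
      have : 1 * g ≤ 2 * (j + s + 1) * (n + 1) * (n + 1 + g) :=
        Nat.mul_le_mul (Nat.mul_pos (by omega) (by omega)) (by omega)
      omega
  have : andrewsSeries g j s - 1 = (andrewsPrefactor * andrewsTerm g j s 0 - 1) +
      andrewsPrefactor * ∑' n, andrewsTerm g j s (n + 1) := by
    rw [andrewsSeries, andrewsSum, (summable_andrewsTerm g j s).tsum_eq_zero_add]
    ring
  rw [this]
  exact dvd_add h0 (hs.mul_left _)

theorem andrewsSeries_zero (g s : ℕ) : andrewsSeries g 0 s = andrewsSeries (g + 1) s 0 := by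
  rw [andrewsSeries, andrewsSum_zero, andrewsSeries]

theorem andrewsSeries_succ (g j s : ℕ) :
    andrewsSeries g (j + 1) s = andrewsSeries g j (s + 1) +
      X ^ (2 * (g + 1) * j + 2 * g + 1) *
        (X * andrewsSeries (g + 1) s (j + 1) + andrewsSeries (g + 1) (s + 1) j) := by
  rw [andrewsSeries, andrewsSum_succ]
  simp only [andrewsSeries]
  ring

/-- A family satisfying Andrews' recursion and tending to `1` is determined. -/
theorem eq_of_recursion {A B : ℕ → ℕ → ℕ → ℚ⟦X⟧} (c : ℕ)
    (hA : ∀ g j s, j + s = c → X ^ g ∣ A g j s - 1)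
    (hB : ∀ g j s, j + s = c → X ^ g ∣ B g j s - 1)
    (hA0 : ∀ g, A g 0 c = A (g + 1) c 0) (hB0 : ∀ g, B g 0 c = B (g + 1) c 0)
    (hAs : ∀ g j s, j + 1 + s = c → A g (j + 1) s = A g j (s + 1) +
      X ^ (2 * (g + 1) * j + 2 * g + 1) * (X * A (g + 1) s (j + 1) + A (g + 1) (s + 1) j))
    (hBs : ∀ g j s, j + 1 + s = c → B g (j + 1) s = B g j (s + 1) +
      X ^ (2 * (g + 1) * j + 2 * g + 1) * (X * B (g + 1) s (j + 1) + B (g + 1) (s + 1) j))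
    (g j s : ℕ) (h : j + s = c) : A g j s = B g j s := by
  refine eq_of_forall_X_pow_dvd_sub fun N => ?_
  have step : ∀ g, (∀ j s, j + s = c → X ^ N ∣ A (g + 1) j s - B (g + 1) j s) →
      ∀ j s, j + s = c → X ^ N ∣ A g j s - B g j s := by
    intro g ih j
    induction j with
    | zero =>
      intro s hs
      obtain rfl : s = c := by omega
      rw [hA0, hB0]
      exact ih _ _ (by omega)
    | succ j ihj =>
      intro s hs
      rw [hAs g j s hs, hBs g j s hs]
      have := dvd_add (ihj (s + 1) (by omega)) (((ih s (j + 1) (by omega)).mul_left X).add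
        (ih (s + 1) j (by omega)) |>.mul_left (X ^ (2 * (g + 1) * j + 2 * g + 1)))
      convert this using 1
      ring
  -- Here `d` counts the levels still to climb: once `g ≥ N`, both families are `1` modulo `X^N`.
  have main : ∀ d g, N ≤ g + d → ∀ j s, j + s = c → X ^ N ∣ A g j s - B g j s := by
    intro d
    induction d with
    | zero =>
      intro g hg j s hs
      have := dvd_sub (hA g j s hs) (hB g j s hs)
      rw [sub_sub_sub_cancel_right] at this
      exact (pow_dvd_pow X (by omega)).trans this
    | succ d ih => exact fun g hg => step g (ih (g + 1) (by omega))
  exact main N g (by omega) j s h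

end GGA

namespace GGA

open PowerSeries

/-! ### Multiplicity functions of partitions -/

theorem weight_id_eq_sum (d : ℕ →₀ ℕ) :
    Finsupp.weight (id : ℕ → ℕ) d = (Finsupp.toMultiset d).sum := by
  rw [Finsupp.weight_apply, Finsupp.toMultiset_apply]
  rw [← Multiset.coe_sumAddMonoidHom, map_finsuppSum]
  simp [Multiset.sum_nsmul]

theorem exists_partition_of_weight {d : ℕ →₀ ℕ} {n : ℕ} (h0 : d 0 = 0)
    (h : Finsupp.weight (id : ℕ → ℕ) d = n) :
    ∃ lam : n.Partition, Multiset.toFinsupp lam.parts = d := by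
  refine ⟨⟨Finsupp.toMultiset d, fun {i} hi => ?_, by rw [← weight_id_eq_sum, h]⟩,
    Finsupp.toMultiset_toFinsupp d⟩
  rw [Finsupp.mem_toMultiset, Finsupp.mem_support_iff] at hi
  exact Nat.pos_of_ne_zero fun hi' => hi (hi' ▸ h0)

/-- A part `0` would have weight `0`, so without `d 0 = 0` these sets could be infinite. -/
theorem finite_setOf_weight {S : Set (ℕ →₀ ℕ)} (hS : ∀ d ∈ S, d 0 = 0) (n : ℕ) :
    {d | d ∈ S ∧ Finsupp.weight (id : ℕ → ℕ) d = n}.Finite :=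
  (Set.finite_range fun lam : n.Partition => Multiset.toFinsupp lam.parts).subset fun d hd =>
    exists_partition_of_weight (hS d hd.1) hd.2

/-- The generating function of a set of multiplicity functions. -/
noncomputable def genFun (S : Set (ℕ →₀ ℕ)) : ℚ⟦X⟧ :=
  PowerSeries.mk fun n => ({d | d ∈ S ∧ Finsupp.weight (id : ℕ → ℕ) d = n}.ncard : ℚ)

theorem genFun_union {S T : Set (ℕ →₀ ℕ)} (hST : Disjoint S T) (hS : ∀ d ∈ S, d 0 = 0)
    (hT : ∀ d ∈ T, d 0 = 0) : genFun (S ∪ T) = genFun S + genFun T := by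
  ext n
  simp only [genFun, coeff_mk, map_add]
  rw [← Nat.cast_add, ← Set.ncard_union_eq _ (finite_setOf_weight hS n) (finite_setOf_weight hT n)]
  · congr 2
    ext d
    simp only [Set.mem_ofPred_eq, Set.mem_union]
    tauto
  · exact Set.disjoint_left.mpr fun d h1 h2 => Set.disjoint_left.mp hST h1.1 h2.1

theorem genFun_image_add (a : ℕ →₀ ℕ) (S : Set (ℕ →₀ ℕ)) :
    genFun ((a + ·) '' S) = X ^ Finsupp.weight (id : ℕ → ℕ) a * genFun S := by
  ext n
  rw [coeff_X_pow_mul']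
  simp only [genFun, coeff_mk]
  split_ifs with h
  · rw [← Set.ncard_image_of_injective {d | d ∈ S ∧ Finsupp.weight (id : ℕ → ℕ) d =
      n - Finsupp.weight (id : ℕ → ℕ) a} (add_right_injective a)]
    congr 2
    ext d
    simp only [Set.mem_ofPred_eq, Set.mem_image]
    constructor
    · rintro ⟨⟨e, he, rfl⟩, h2⟩
      rw [map_add] at h2
      exact ⟨e, ⟨he, by omega⟩, rfl⟩
    · rintro ⟨e, ⟨he, h2⟩, rfl⟩
      refine ⟨⟨e, he, rfl⟩, ?_⟩
      rw [map_add]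
      omega
  · refine Nat.cast_eq_zero.mpr ((congrArg Set.ncard ?_).trans (Set.ncard_empty (ℕ →₀ ℕ)))
    ext d
    simp only [Set.mem_ofPred_eq, Set.mem_image, Set.mem_empty_iff_false, iff_false]
    rintro ⟨⟨e, he, rfl⟩, h2⟩
    rw [map_add] at h2
    omega

/-- The multiplicity functions of the partitions counted by `E_{r,i,J}`, with `i = j + 1` and
`r = j + s + 1`. -/
def admissibleMults (J j s : ℕ) : Set (ℕ →₀ ℕ) :=
  {d | (∀ n, n ≤ 2 * J → d n = 0) ∧ (∀ a, Odd a → d a ≤ 1) ∧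
    d (2 * J + 1) + d (2 * J + 2) ≤ j ∧
    ∀ c, J < c → d (2 * c) + d (2 * c + 1) + d (2 * c + 2) ≤ j + s}

theorem apply_zero_of_mem_admissibleMults {J j s : ℕ} {d : ℕ →₀ ℕ}
    (hd : d ∈ admissibleMults J j s) : d 0 = 0 := hd.1 0 (Nat.zero_le _)

/-- With neither `2J+1` nor `2J+2` present, the window at `c = J + 1` bounds the parts `2J+3` and
`2J+4` by `s`. -/
theorem admissibleMults_zero (J s : ℕ) :
    admissibleMults J 0 s = admissibleMults (J + 1) s 0 := by
  ext d
  constructor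
  · rintro ⟨h1, h2, h3, h4⟩
    refine ⟨fun n hn => ?_, h2, ?_, fun c hc => ?_⟩
    · rcases Nat.lt_or_ge (2 * J) n with h | h
      · obtain rfl | rfl : n = 2 * J + 1 ∨ n = 2 * J + 2 := by omega
        · omega
        · omega
      · exact h1 n h
    · have := h4 (J + 1) (Nat.lt_succ_self J)
      omega
    · have := h4 c (by omega)
      omega
  · rintro ⟨h1, h2, h3, h4⟩
    refine ⟨fun n hn => h1 n (by omega), h2, ?_, fun c hc => ?_⟩
    · rw [h1 _ (by omega), h1 _ (by omega)]
    · rcases Nat.lt_or_ge (J + 1) c with h | h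
      · have := h4 c h
        omega
      · obtain rfl : c = J + 1 := by omega
        have := h1 (2 * (J + 1)) le_rfl
        omega

/-- Either at most `j` parts equal `2J+1` or `2J+2`, or exactly `j + 1` do. In the latter case
`2J+1` occurs at most once, so there are two possibilities; removing these parts leaves room in the
window at `c = J + 1` for `s` or `s + 1` parts equal to `2J+3` or `2J+4`. -/
theorem admissibleMults_succ (J j s : ℕ) :
    admissibleMults J (j + 1) s = admissibleMults J j (s + 1) ∪
      (((Finsupp.single (2 * J + 2) (j + 1) + ·) '' admissibleMults (J + 1) s (j + 1)) ∪
        ((Finsupp.single (2 * J + 1) 1 + Finsupp.single (2 * J + 2) j + ·) ''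
          admissibleMults (J + 1) (s + 1) j)) := by
  ext d
  simp only [Set.mem_union, Set.mem_image]
  constructor
  · rintro ⟨h1, h2, h3, h4⟩
    have h5 := h2 (2 * J + 1) ⟨J, rfl⟩
    have h6 := h4 (J + 1) (Nat.lt_succ_self J)
    rcases Nat.lt_or_ge j (d (2 * J + 1) + d (2 * J + 2)) with h | h
    · right
      rcases Nat.eq_zero_or_pos (d (2 * J + 1)) with h0 | h0
      · left
        have hle : Finsupp.single (2 * J + 2) (j + 1) ≤ d := by
          rw [Finsupp.single_le_iff]; omega
        refine ⟨d - Finsupp.single (2 * J + 2) (j + 1), ⟨fun n hn => ?_, fun a ha => ?_, ?_,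
          fun c hc => ?_⟩, add_tsub_cancel_of_le hle⟩
        · rw [Finsupp.tsub_apply, Finsupp.single_apply]
          rcases Nat.lt_or_ge (2 * J) n with h' | h'
          · obtain rfl | rfl : n = 2 * J + 1 ∨ n = 2 * J + 2 := by omega
            · omega
            · simp; omega
          · rw [h1 n h', Nat.zero_sub]
        · rw [Finsupp.tsub_apply]
          exact (Nat.sub_le _ _).trans (h2 a ha)
        · simp only [Finsupp.tsub_apply]
          rw [Finsupp.single_eq_of_ne (by omega), Finsupp.single_eq_of_ne (by omega)]
          rw [show 2 * (J + 1) = 2 * J + 2 by ring] at h6 ⊢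
          omega
        · simp only [Finsupp.tsub_apply]
          have := h4 c (by omega)
          omega
      · right
        have hv : ∀ n, (Finsupp.single (2 * J + 1) 1 + Finsupp.single (2 * J + 2) j : ℕ →₀ ℕ) n =
            if n = 2 * J + 1 then 1 else if n = 2 * J + 2 then j else 0 := by
          intro n
          rw [Finsupp.add_apply, Finsupp.single_apply, Finsupp.single_apply]
          split_ifs <;> omega
        have hle : Finsupp.single (2 * J + 1) 1 + Finsupp.single (2 * J + 2) j ≤ d := by
          intro n
          rw [hv]
          split_ifs with e1 e2
          · subst e1; omega
          · subst e2; omega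
          · omega
        refine ⟨d - (Finsupp.single (2 * J + 1) 1 + Finsupp.single (2 * J + 2) j),
          ⟨fun n hn => ?_, fun a ha => ?_, ?_, fun c hc => ?_⟩, add_tsub_cancel_of_le hle⟩
        · rw [Finsupp.tsub_apply, hv]
          split_ifs with e1 e2
          · subst e1; omega
          · subst e2; omega
          · rw [h1 n (by omega)]
        · rw [Finsupp.tsub_apply]
          exact (Nat.sub_le _ _).trans (h2 a ha)
        · simp only [Finsupp.tsub_apply]
          rw [show 2 * (J + 1) = 2 * J + 2 by ring] at h6 ⊢
          omega
        · simp only [Finsupp.tsub_apply]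
          have := h4 c (by omega)
          omega
    · left
      refine ⟨h1, h2, h, fun c hc => ?_⟩
      have := h4 c hc
      omega
  · rintro (⟨h1, h2, h3, h4⟩ | ⟨e, ⟨h1, h2, h3, h4⟩, rfl⟩ | ⟨e, ⟨h1, h2, h3, h4⟩, rfl⟩)
    · refine ⟨h1, h2, by omega, fun c hc => ?_⟩
      have := h4 c hc
      omega
    · have hv : ∀ n, (Finsupp.single (2 * J + 2) (j + 1) + e : ℕ →₀ ℕ) n =
          if n = 2 * J + 2 then j + 1 else e n := by
        intro n
        rw [Finsupp.add_apply, Finsupp.single_apply]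
        split_ifs with c1 c2 c2
        · rw [h1 n (by omega)]
        · omega
        · omega
        · omega
      have k1 := h1 (2 * J + 1) (by omega)
      refine ⟨fun n hn => ?_, fun a ha => ?_, ?_, fun c hc => ?_⟩
      · simp only [hv]
        rw [if_neg (by omega), h1 n (by omega)]
      · simp only [hv]
        rw [if_neg (by rintro rfl; rcases ha with ⟨k, hk⟩; omega)]
        exact h2 a ha
      · simp only [hv]
        simp [k1]
      · simp only [hv]
        rcases Nat.lt_or_ge (J + 1) c with h | h
        · rw [if_neg (by omega), if_neg (by omega), if_neg (by omega)]
          have := h4 c h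
          omega
        · obtain rfl : c = J + 1 := by omega
          rw [if_pos (by ring), if_neg (by omega), if_neg (by omega)]
          omega
    · have hv : ∀ n, (Finsupp.single (2 * J + 1) 1 + Finsupp.single (2 * J + 2) j + e : ℕ →₀ ℕ) n =
          if n = 2 * J + 1 then 1 else if n = 2 * J + 2 then j else e n := by
        intro n
        rw [Finsupp.add_apply, Finsupp.add_apply, Finsupp.single_apply, Finsupp.single_apply]
        split_ifs with c1 c2 c3 c4 c5 c6 c7 c8
        all_goals first | omega | (rw [h1 n (by omega)]; omega)
      refine ⟨fun n hn => ?_, fun a ha => ?_, ?_, fun c hc => ?_⟩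
      · simp only [hv]
        rw [if_neg (by omega), if_neg (by omega), h1 n (by omega)]
      · simp only [hv]
        have := h2 a ha
        rcases ha with ⟨k, hk⟩
        split_ifs <;> omega
      · simp only [hv]
        simp [add_comm]
      · simp only [hv]
        rcases Nat.lt_or_ge (J + 1) c with h | h
        · have := h4 c h
          rw [if_neg (by omega), if_neg (by omega), if_neg (by omega), if_neg (by omega),
            if_neg (by omega), if_neg (by omega)]
          omega
        · obtain rfl : c = J + 1 := by omega
          rw [if_neg (by omega), if_pos (by ring), if_neg (by omega), if_neg (by omega),
            if_neg (by omega), if_neg (by omega)]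
          omega

theorem genFun_admissibleMults_zero (J s : ℕ) :
    genFun (admissibleMults J 0 s) = genFun (admissibleMults (J + 1) s 0) := by
  rw [admissibleMults_zero]

theorem genFun_admissibleMults_succ (J j s : ℕ) :
    genFun (admissibleMults J (j + 1) s) = genFun (admissibleMults J j (s + 1)) +
      X ^ (2 * (J + 1) * j + 2 * J + 1) * (X * genFun (admissibleMults (J + 1) s (j + 1)) +
        genFun (admissibleMults (J + 1) (s + 1) j)) := by
  have z1 : ∀ d ∈ (Finsupp.single (2 * J + 2) (j + 1) + ·) '' admissibleMults (J + 1) s (j + 1),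
      d 0 = 0 ∧ d (2 * J + 1) = 0 ∧ d (2 * J + 2) = j + 1 := by
    rintro _ ⟨e, he, rfl⟩
    have a0 := he.1 0 (by omega)
    have a1 := he.1 (2 * J + 1) (by omega)
    have a2 := he.1 (2 * J + 2) (by omega)
    simp [a0, a1, a2]
  have z2 : ∀ d ∈ (Finsupp.single (2 * J + 1) 1 + Finsupp.single (2 * J + 2) j + ·) ''
      admissibleMults (J + 1) (s + 1) j,
      d 0 = 0 ∧ d (2 * J + 1) = 1 ∧ d (2 * J + 2) = j := by
    rintro _ ⟨e, he, rfl⟩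
    have a0 := he.1 0 (by omega)
    have a1 := he.1 (2 * J + 1) (by omega)
    have a2 := he.1 (2 * J + 2) (by omega)
    simp [a0, a1, a2]
  rw [admissibleMults_succ, genFun_union, genFun_union, genFun_image_add, genFun_image_add,
    map_add, Finsupp.weight_single, Finsupp.weight_single, Finsupp.weight_single]
  · simp only [smul_eq_mul, id]
    ring
  · refine Set.disjoint_left.mpr fun d h1 h2 => ?_
    have := z1 d h1
    have := z2 d h2
    omega
  · exact fun d hd => (z1 d hd).1
  · exact fun d hd => (z2 d hd).1
  · refine Set.disjoint_left.mpr fun d h1 h2 => ?_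
    have h3 := h1.2.2.1
    rcases h2 with h2 | h2
    · have := z1 d h2
      omega
    · have := z2 d h2
      omega
  · exact fun d hd => apply_zero_of_mem_admissibleMults hd
  · rintro d (hd | hd)
    · exact (z1 d hd).1
    · exact (z2 d hd).1

theorem X_pow_dvd_genFun_admissibleMults_sub_one (J j s : ℕ) :
    X ^ J ∣ genFun (admissibleMults J j s) - 1 := by
  rw [X_pow_dvd_iff]
  intro n hn
  have h0 : ∀ d ∈ admissibleMults J j s, Finsupp.weight (id : ℕ → ℕ) d = n → d = 0 := by
    intro d hd hw
    ext k
    by_contra hk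
    have h1 := Finsupp.le_weight_of_ne_zero' (id : ℕ → ℕ) hk
    rw [hw, id] at h1
    exact hk (hd.1 k (by omega))
  rw [map_sub, sub_eq_zero, coeff_one, genFun, coeff_mk]
  split_ifs with hn0
  · subst hn0
    rw [Nat.cast_eq_one, Set.ncard_eq_one]
    refine ⟨0, Set.eq_singleton_iff_unique_mem.mpr ⟨⟨?_, map_zero _⟩, fun d hd => h0 d hd.1 hd.2⟩⟩
    simp [admissibleMults]
  · refine Nat.cast_eq_zero.mpr ((congrArg Set.ncard ?_).trans (Set.ncard_empty (ℕ →₀ ℕ)))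
    ext d
    simp only [Set.mem_ofPred_eq, Set.mem_empty_iff_false, iff_false]
    rintro ⟨h1, h2⟩
    rw [h0 d h1 h2, map_zero] at h2
    exact hn0 h2.symm

theorem genFun_admissibleMults_eq_andrewsSeries (J j s : ℕ) :
    genFun (admissibleMults J j s) = andrewsSeries J j s :=
  eq_of_recursion (A := fun J j s => genFun (admissibleMults J j s)) (B := andrewsSeries) (j + s)
    (fun _ _ _ _ => X_pow_dvd_genFun_admissibleMults_sub_one _ _ _)
    (fun _ _ _ _ => X_pow_dvd_andrewsSeries_sub_one _ _ _)
    (fun _ => genFun_admissibleMults_zero _ _) (fun _ => andrewsSeries_zero _ _)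
    (fun _ _ _ _ => genFun_admissibleMults_succ _ _ _) (fun _ _ _ _ => andrewsSeries_succ _ _ _)
    J j s rfl

/-! ### Partitions and their multiplicity functions -/

/-- Translates statements about the `k`-th entry into statements about the number of entries at
least `v`, from which windows are obtained by subtraction. -/
theorem le_getElem_iff_lt_countP {l : List ℕ} (hl : l.Pairwise (· ≥ ·)) (v : ℕ) :
    ∀ (k : ℕ) (h : k < l.length), v ≤ l[k] ↔ k < l.countP (v ≤ ·) := by
  induction l with
  | nil => intro k h; simp at h
  | cons a l ih =>
    intro k h
    rw [List.pairwise_cons] at hl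
    rw [List.countP_cons]
    rcases Nat.lt_or_ge a v with hav | hav
    · have h0 : l.countP (v ≤ ·) = 0 := by
        rw [List.countP_eq_zero]
        intro b hb
        have := hl.1 b hb
        simp; omega
      rw [h0]
      simp only [decide_eq_true_eq, if_neg (by omega : ¬ v ≤ a)]
      rcases k with _ | k
      · simp; omega
      · have := hl.1 _ (List.getElem_mem (by simpa using h : k < l.length))
        simp; omega
    · simp only [decide_eq_true_eq, if_pos hav]
      rcases k with _ | k
      · simp [hav]
      · have := ih hl.2 k (by simpa using h)
        simp [this]

theorem countP_le_eq (l : List ℕ) (v : ℕ) :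
    l.countP (v ≤ ·) = l.count v + l.countP (v + 1 ≤ ·) := by
  induction l with
  | nil => simp
  | cons a l ih =>
    rw [List.countP_cons, List.countP_cons, List.count_cons, ih]
    simp only [decide_eq_true_eq, beq_iff_eq]
    split_ifs <;> omega

/-- For a weakly decreasing list, the difference conditions at distance `p` bound the numbers of
entries in the windows `2 c, 2 c + 1, 2 c + 2`. -/
theorem difference_conditions_iff {l : List ℕ} (hl : l.Pairwise (· ≥ ·)) {p J j : ℕ} (hjp : j ≤ p)
    (h1 : ∀ a, Odd a → l.count a ≤ 1) (h3 : ∀ n, n ≤ 2 * J → l.count n = 0)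
    (h4 : l.count (2 * J + 1) + l.count (2 * J + 2) ≤ j) :
    (∀ (m : ℕ) (_ : m + p < l.length), (Odd l[m] → l[m + p] + 2 ≤ l[m]) ∧
      (Even l[m] → l[m + p] + 3 ≤ l[m])) ↔
    ∀ c, J < c → l.count (2 * c) + l.count (2 * c + 1) + l.count (2 * c + 2) ≤ p := by
  have hget := le_getElem_iff_lt_countP hl
  have hN := countP_le_eq l
  have hcard : ∀ v, l.countP (v ≤ ·) ≤ l.length := fun v => List.countP_le_length
  obtain ⟨N, hNdef⟩ : ∃ N : ℕ → ℕ, ∀ v, l.countP (v ≤ ·) = N v := ⟨_, fun _ => rfl⟩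
  simp only [hNdef] at hget hN hcard
  constructor
  · intro h2 c hc
    by_contra hgt
    push Not at hgt
    have n0 : N (2 * c) = l.count (2 * c) + N (2 * c + 1) := hN _
    have n1 : N (2 * c + 1) = l.count (2 * c + 1) + N (2 * c + 2) := hN _
    have n2 : N (2 * c + 2) = l.count (2 * c + 2) + N (2 * c + 3) := hN _
    have o1 := h1 (2 * c + 1) ⟨c, rfl⟩
    -- Here `t` is the largest value of the overfull window that occurs. Its first occurrence has
    -- index `N (t + 1)`, and `p` places later the entry is still at least `2c`, against the
    -- difference condition at `t`.
    have main : ∀ t t', t + 1 = t' → N t' < N t → N t' + p < N (2 * c) →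
        (Odd t → t = 2 * c + 1) → (Even t → t ≤ 2 * c + 2) → False := by
      rintro t _ rfl e2 e3 e4 e5
      have c0 := hcard (2 * c)
      have hm : N (t + 1) + p < l.length := by omega
      have hm' : N (t + 1) < l.length := by omega
      have g1 := (hget t _ hm').mpr e2
      have g2 := (hget (t + 1) _ hm').not.mpr (lt_irrefl _)
      have g3 := (hget (2 * c) _ hm).mpr e3
      have g4 : l[N (t + 1)] = t := by omega
      have g5 := h2 _ hm
      rw [g4] at g5
      rcases Nat.even_or_odd t with ht | ht
      · have := g5.2 ht
        have := e5 ht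
        omega
      · have := g5.1 ht
        have := e4 ht
        omega
    rcases Nat.eq_zero_or_pos (l.count (2 * c + 2)) with k2 | k2
    · rcases Nat.eq_zero_or_pos (l.count (2 * c + 1)) with k1 | k1
      · exact main (2 * c) (2 * c + 1) rfl (by omega) (by omega) (fun h => by rcases h with ⟨k, hk⟩; omega)
          (fun _ => by omega)
      · exact main (2 * c + 1) (2 * c + 2) rfl (by omega) (by omega) (fun _ => rfl) (fun _ => by omega)
    · exact main (2 * c + 2) (2 * c + 3) rfl (by omega) (by omega)
        (fun h => by rcases h with ⟨k, hk⟩; omega) (fun _ => by omega)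
  · intro h2 m hm
    have hm' : m < l.length := by omega
    -- The window at `c = J` is bounded as well: `2J` does not occur, and the initial condition with
    -- `j ≤ p` covers the rest.
    have hwin : ∀ c, J ≤ c →
        l.count (2 * c) + l.count (2 * c + 1) + l.count (2 * c + 2) ≤ p := by
      intro c hc
      rcases Nat.lt_or_ge J c with h | h
      · exact h2 c h
      · obtain rfl : c = J := by omega
        have := h3 (2 * c) le_rfl
        omega
    have hgt : 2 * J < l[m] := by
      by_contra hlt
      exact List.count_eq_zero.mp (h3 _ (not_lt.mp hlt)) (List.getElem_mem hm')
    constructor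
    · rintro ⟨c, hc⟩
      by_contra hlt
      have g1 := (hget (2 * c) (m + p) hm).mp (by omega)
      have g2 := (hget (2 * c + 2) m hm').not.mp (by omega)
      have n0 : N (2 * c) = l.count (2 * c) + N (2 * c + 1) := hN _
      have n1 : N (2 * c + 1) = l.count (2 * c + 1) + N (2 * c + 2) := hN _
      have := hwin c (by omega)
      omega
    · rintro ⟨c, hc⟩
      obtain ⟨c, rfl⟩ : ∃ c', c = c' + 1 := ⟨c - 1, by omega⟩
      by_contra hlt
      have g1 := (hget (2 * c) (m + p) hm).mp (by omega)
      have g2 := (hget (2 * c + 3) m hm').not.mp (by omega)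
      have n0 : N (2 * c) = l.count (2 * c) + N (2 * c + 1) := hN _
      have n1 : N (2 * c + 1) = l.count (2 * c + 1) + N (2 * c + 2) := hN _
      have n2 : N (2 * c + 2) = l.count (2 * c + 2) + N (2 * c + 3) := hN _
      have := hwin c (by omega)
      omega

theorem isAdmissible_iff {j s J n : ℕ} (lam : n.Partition) :
    IsAdmissible (j + s + 1) (j + 1) J lam ↔
      Multiset.toFinsupp lam.parts ∈ admissibleMults J j s := by
  have hcount : ∀ a, lam.parts.count a = (lam.parts.sort (· ≥ ·)).count a := fun a => by
    conv_lhs => rw [← Multiset.sort_eq lam.parts (· ≥ ·), Multiset.coe_count]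
  have hpos : (∀ a ∈ lam.parts, 2 * J < a) ↔ ∀ n, n ≤ 2 * J → lam.parts.count n = 0 := by
    constructor
    · intro h m hm
      rw [Multiset.count_eq_zero]
      intro hm'
      have := h m hm'
      omega
    · intro h a ha
      by_contra hlt
      exact Multiset.count_eq_zero.mp (h a (by omega)) ha
  unfold IsAdmissible admissibleMults
  rw [hpos]
  simp only [Set.mem_ofPred_eq, Multiset.toFinsupp_apply, Nat.add_sub_cancel, hcount]
  have key := difference_conditions_iff (l := lam.parts.sort (· ≥ ·)) (p := j + s) (J := J)
    (Multiset.pairwise_sort _ _) (Nat.le_add_right j s)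
  constructor
  · rintro ⟨h1, h2, h3, h4⟩
    exact ⟨h3, h1, h4, (key h1 h3 h4).mp h2⟩
  · rintro ⟨h3, h1, h4, h2⟩
    exact ⟨h1, (key h1 h3 h4).mpr h2, h3, h4⟩

theorem calE_eq_genFun (j s J : ℕ) :
    calE (j + s + 1) (j + 1) J = genFun (admissibleMults J j s) := by
  ext n
  simp only [calE, genFun, coeff_mk, E]
  have hinj : Function.Injective fun lam : n.Partition => Multiset.toFinsupp lam.parts :=
    fun a b h => Nat.Partition.ext (Multiset.toFinsupp.injective h)
  rw [show Nat.card {lam : n.Partition // IsAdmissible (j + s + 1) (j + 1) J lam} =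
      {lam : n.Partition | IsAdmissible (j + s + 1) (j + 1) J lam}.ncard from
      Nat.card_coe_set_eq _, ← Set.ncard_image_of_injective _ hinj]
  congr 2
  ext d
  simp only [Set.mem_image, Set.mem_ofPred_eq]
  constructor
  · rintro ⟨lam, h, rfl⟩
    refine ⟨(isAdmissible_iff lam).mp h, ?_⟩
    rw [weight_id_eq_sum, Multiset.toFinsupp_toMultiset, lam.parts_sum]
  · rintro ⟨h1, h2⟩
    obtain ⟨lam, rfl⟩ := exists_partition_of_weight (apply_zero_of_mem_admissibleMults h1) h2
    exact ⟨lam, (isAdmissible_iff lam).mpr h1, rfl⟩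

end GGA

namespace GGA

/-! ### Hilbert series of monomial ideals -/

section Algebra

variable {F : Type*} [Field F]

/-- For a monomial ideal, the monomials outside it form a basis of the quotient. They are
independent because every monomial in the support of an element of the ideal is a multiple of a
generator. -/
theorem finrank_quotientPart_span {k : ℕ} {G : Set (S F k)}
    (hG : ∀ f ∈ G, ∃ e, f = MvPolynomial.monomial e 1) (j : ℕ) :
    Module.finrank F (quotientPart F k (Ideal.span G) j) =
      {d : {n : ℕ // k ≤ n} →₀ ℕ |
        (∀ f ∈ G, ¬ f ∣ MvPolynomial.monomial d 1) ∧
          Finsupp.weight (fun n : {n : ℕ // k ≤ n} => (n : ℕ)) d = j}.ncard := by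
  set A : Set ({n : ℕ // k ≤ n} →₀ ℕ) := {d | (∀ f ∈ G, ¬ f ∣ MvPolynomial.monomial d 1) ∧
          Finsupp.weight (fun n : {n : ℕ // k ≤ n} => (n : ℕ)) d = j} with hA
  have hGs : G = (fun e => MvPolynomial.monomial e (1 : F)) ''
      {e | MvPolynomial.monomial e (1 : F) ∈ G} := by
    ext f
    constructor
    · intro hf
      obtain ⟨e, rfl⟩ := hG f hf
      exact ⟨e, hf, rfl⟩
    · rintro ⟨e, he, rfl⟩
      exact he
  set φ := (Ideal.Quotient.mkₐ F (Ideal.span G)).toLinearMap ∘ₗ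
    (MvPolynomial.restrictSupport F A).subtype with hφ
  have hinj : Function.Injective φ := by
    rw [← LinearMap.ker_eq_bot, LinearMap.ker_eq_bot']
    rintro ⟨p, hp⟩ h0
    have h1 : p ∈ Ideal.span G := Ideal.Quotient.eq_zero_iff_mem.mp h0
    rw [hGs, MvPolynomial.mem_ideal_span_monomial_image] at h1
    rw [MvPolynomial.mem_restrictSupport_iff] at hp
    rw [Subtype.ext_iff]
    change p = 0
    rw [← MvPolynomial.support_eq_empty, Finset.eq_empty_iff_forall_notMem]
    intro d hd
    obtain ⟨e, he, hed⟩ := h1 d hd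
    exact (hp hd).1 _ he (MvPolynomial.monomial_dvd_monomial.mpr ⟨Or.inr hed, dvd_refl 1⟩)
  have hrange : LinearMap.range φ = quotientPart F k (Ideal.span G) j := by
    have hw : weightPart F k j = MvPolynomial.restrictSupport F
        {d | Finsupp.weight (fun n : {n : ℕ // k ≤ n} => (n : ℕ)) d = j} :=
      MvPolynomial.weightedHomogeneousSubmodule_eq_finsupp_supported _ _ _
    rw [hφ, LinearMap.range_comp, Submodule.range_subtype, quotientPart, hw]
    refine le_antisymm (Submodule.map_mono (MvPolynomial.restrictSupport_mono F fun d hd => hd.2)) ?_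
    rw [MvPolynomial.restrictSupport_eq_span (R := F)
      {d | Finsupp.weight (fun n : {n : ℕ // k ≤ n} => (n : ℕ)) d = j}, Submodule.map_span,
      Submodule.span_le]
    rintro _ ⟨_, ⟨d, hd, rfl⟩, rfl⟩
    by_cases hdA : ∀ f ∈ G, ¬ f ∣ MvPolynomial.monomial d 1
    · exact Submodule.mem_map_of_mem
        ((MvPolynomial.monomial_mem_restrictSupport F).mpr (Or.inl ⟨hdA, hd⟩))
    · push Not at hdA
      obtain ⟨f, hf, hfd⟩ := hdA
      have h0 : (Ideal.Quotient.mkₐ F (Ideal.span G)).toLinearMap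
          (MvPolynomial.monomial d (1 : F)) = 0 :=
        Ideal.Quotient.eq_zero_iff_mem.mpr (Ideal.mem_of_dvd _ hfd (Ideal.subset_span hf))
      rw [h0]
      exact Submodule.zero_mem _
  rw [← hrange, LinearMap.finrank_range_of_inj hinj,
    Module.finrank_eq_nat_card_basis (MvPolynomial.basisRestrictSupport F A),
    Nat.card_coe_set_eq]

/-- The monomial of `S_k` with exponents `t`. -/
noncomputable def expMonomial (F : Type*) [Field F] (k : ℕ) (t : ℕ →₀ ℕ) : S F k :=
  MvPolynomial.monomial (t.subtypeDomain (k ≤ ·)) 1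

theorem expMonomial_add (k : ℕ) (t u : ℕ →₀ ℕ) :
    expMonomial F k (t + u) = expMonomial F k t * expMonomial F k u := by
  rw [expMonomial, expMonomial, expMonomial, MvPolynomial.monomial_mul, one_mul,
    Finsupp.subtypeDomain_add]

theorem x_pow_eq {k m : ℕ} (hm : k ≤ m) (a : ℕ) :
    x F k m ^ a = expMonomial F k (Finsupp.single m a) := by
  rw [x, dif_pos hm, MvPolynomial.X_pow_eq_monomial, expMonomial]
  refine congrArg (fun e => MvPolynomial.monomial e (1 : F)) (Finsupp.ext fun ⟨n, hn⟩ => ?_)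
  simp [Finsupp.single_apply]

theorem expMonomial_dvd_iff {k : ℕ} {t : ℕ →₀ ℕ} {d : {n : ℕ // k ≤ n} →₀ ℕ} :
    expMonomial F k t ∣ MvPolynomial.monomial d 1 ↔
      ∀ n, k ≤ n → t n ≤ d.extendDomain n := by
  rw [expMonomial, MvPolynomial.monomial_dvd_monomial]
  simp only [one_ne_zero, false_or, dvd_refl, and_true]
  constructor
  · intro h n hn
    have := h ⟨n, hn⟩
    simpa [hn] using this
  · rintro h ⟨n, hn⟩
    have := h n hn
    simpa [hn] using this

theorem x_mul_x_mul_x_eq {k m₁ m₂ m₃ : ℕ} (h₁ : k ≤ m₁) (h₂ : k ≤ m₂) (h₃ : k ≤ m₃)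
    (a b c : ℕ) : x F k m₁ ^ a * x F k m₂ ^ b * x F k m₃ ^ c =
      expMonomial F k (Finsupp.single m₁ a + Finsupp.single m₂ b + Finsupp.single m₃ c) := by
  rw [x_pow_eq h₁, x_pow_eq h₂, x_pow_eq h₃, expMonomial_add, expMonomial_add]

theorem x_mul_x_mul_x_dvd_iff {k m₁ m₂ m₃ : ℕ} (h₁ : k ≤ m₁) (h₁₂ : m₁ < m₂) (h₂₃ : m₂ < m₃)
    {a b c : ℕ} {d : {n : ℕ // k ≤ n} →₀ ℕ} :
    x F k m₁ ^ a * x F k m₂ ^ b * x F k m₃ ^ c ∣ MvPolynomial.monomial d 1 ↔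
      a ≤ d.extendDomain m₁ ∧ b ≤ d.extendDomain m₂ ∧ c ≤ d.extendDomain m₃ := by
  rw [x_mul_x_mul_x_eq h₁ (by omega) (by omega), expMonomial_dvd_iff]
  constructor
  · intro h
    have e₁ := h m₁ h₁
    have e₂ := h m₂ (by omega)
    have e₃ := h m₃ (by omega)
    rw [Finsupp.add_apply, Finsupp.add_apply] at e₁ e₂ e₃
    simp only [Finsupp.single_eq_same] at e₁ e₂ e₃
    omega
  · rintro ⟨e₁, e₂, e₃⟩ n hn
    rw [Finsupp.add_apply, Finsupp.add_apply, Finsupp.single_apply, Finsupp.single_apply,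
      Finsupp.single_apply]
    split_ifs <;> subst_vars <;> omega

theorem x_mul_x_dvd_iff {k m₁ m₂ : ℕ} (h₁ : k ≤ m₁) (h₁₂ : m₁ < m₂)
    {a b : ℕ} {d : {n : ℕ // k ≤ n} →₀ ℕ} :
    x F k m₁ ^ a * x F k m₂ ^ b ∣ MvPolynomial.monomial d 1 ↔
      a ≤ d.extendDomain m₁ ∧ b ≤ d.extendDomain m₂ := by
  have := x_mul_x_mul_x_dvd_iff (F := F) h₁ h₁₂ (Nat.lt_succ_self m₂) (a := a) (b := b) (c := 0)
    (d := d)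
  simpa using this

theorem x_dvd_iff {k m : ℕ} (h : k ≤ m) {a : ℕ} {d : {n : ℕ // k ≤ n} →₀ ℕ} :
    x F k m ^ a ∣ MvPolynomial.monomial d 1 ↔ a ≤ d.extendDomain m := by
  have := x_mul_x_dvd_iff (F := F) h (Nat.lt_succ_self m) (a := a) (b := 0) (d := d)
  simpa using this

/-- The generators of `L_{r,i,J}`, with `i = j + 1` and `r = j + s + 1`, are monomials. -/
theorem exists_monomial_of_mem {j s J : ℕ} {f : S F (2 * J + 1)}
    (hf : f ∈ ({x F (2 * J + 1) (2 * J + 1) ^ 2,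
      x F (2 * J + 1) (2 * J + 1) * x F (2 * J + 1) (2 * J + 2) ^ j,
      x F (2 * J + 1) (2 * J + 2) ^ (j + 1)} ∪
    gensL F (2 * J + 1) (j + s + 1) (2 * J + 2) : Set (S F (2 * J + 1)))) :
    ∃ e, f = MvPolynomial.monomial e 1 := by
  have key : ∀ (m₁ m₂ m₃ a b c : ℕ), 2 * J + 1 ≤ m₁ → 2 * J + 1 ≤ m₂ → 2 * J + 1 ≤ m₃ →
      f = x F (2 * J + 1) m₁ ^ a * x F (2 * J + 1) m₂ ^ b * x F (2 * J + 1) m₃ ^ c →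
      ∃ e, f = MvPolynomial.monomial e 1 := fun m₁ m₂ m₃ a b c h₁ h₂ h₃ h =>
    ⟨_, h.trans (x_mul_x_mul_x_eq h₁ h₂ h₃ a b c)⟩
  rcases hf with (rfl | rfl | rfl) |
    (((⟨m, hm, hJ, rfl⟩ | ⟨m, hm, hJ, rfl⟩) | ⟨m, n, hm, hJ, hn, rfl⟩) | ⟨m, n, hm, hJ, hn, rfl⟩)
  · exact key (2 * J + 1) (2 * J + 1) (2 * J + 1) 2 0 0 (by omega) (by omega) (by omega) (by ring)
  · exact key (2 * J + 1) (2 * J + 2) (2 * J + 2) 1 j 0 (by omega) (by omega) (by omega) (by ring)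
  · exact key (2 * J + 2) (2 * J + 2) (2 * J + 2) (j + 1) 0 0 (by omega) (by omega) (by omega)
      (by ring)
  · exact key m m m 2 0 0 (by omega) (by omega) (by omega) (by ring)
  · exact key m (m + 1) m 1 (j + s + 1 - 1) 0 (by omega) (by omega) (by omega) (by ring)
  · exact key m (m + 2) m (j + s + 1 - n) n 0 (by omega) (by omega) (by omega) (by ring)
  · exact key m (m + 1) (m + 2) (j + s + 1 - n - 1) 1 n (by omega) (by omega) (by omega) (by ring)

theorem avoids_iff {j s J : ℕ} (hr : 1 ≤ j + s) (d : {n : ℕ // 2 * J + 1 ≤ n} →₀ ℕ) :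
    (∀ f ∈ ({x F (2 * J + 1) (2 * J + 1) ^ 2,
      x F (2 * J + 1) (2 * J + 1) * x F (2 * J + 1) (2 * J + 2) ^ j,
      x F (2 * J + 1) (2 * J + 2) ^ (j + 1)} ∪
      gensL F (2 * J + 1) (j + s + 1) (2 * J + 2) : Set (S F (2 * J + 1))),
        ¬ f ∣ MvPolynomial.monomial d 1) ↔ d.extendDomain ∈ admissibleMults J j s := by
  have hlow : ∀ n, n ≤ 2 * J → d.extendDomain n = 0 := fun n hn => by
    simp [show ¬ 2 * J + 1 ≤ n by omega]
  constructor
  · intro h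
    have a1 := h _ (Or.inl (Or.inl rfl))
    have a2 := h _ (Or.inl (Or.inr (Or.inl rfl)))
    have a3 := h _ (Or.inl (Or.inr (Or.inr rfl)))
    rw [x_dvd_iff (by omega)] at a1 a3
    nth_rewrite 1 [← pow_one (x F (2 * J + 1) (2 * J + 1))] at a2
    rw [x_mul_x_dvd_iff (by omega) (by omega)] at a2
    have hodd : ∀ a, Odd a → d.extendDomain a ≤ 1 := by
      intro a ha
      rcases Nat.lt_or_ge a (2 * J + 2) with hlt | hge
      · rcases Nat.lt_or_ge (2 * J) a with h' | h'
        · obtain rfl : a = 2 * J + 1 := by omega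
          omega
        · rw [hlow a h']
          omega
      · have := h _ (Or.inr (Or.inl (Or.inl (Or.inl ⟨a, ha, hge, rfl⟩))))
        rw [x_dvd_iff (by omega)] at this
        omega
    refine ⟨hlow, hodd, by omega, fun c hc => ?_⟩
    by_contra hgt
    have b1 := hodd (2 * c + 1) ⟨c, rfl⟩
    -- An overfull window contains a generator: take the exponent of `x_{2c+2}` as `n₁` or `n₂`,
    -- according to whether `x_{2c+1}` is absent or present. If that exponent is too large for this,
    -- `x_{2c+2}^r` or `x_{2c+1} x_{2c+2}^(r-1)` serves instead.
    rcases Nat.eq_zero_or_pos (d.extendDomain (2 * c + 1)) with h0 | h0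
    · rcases Nat.lt_or_ge (j + s) (d.extendDomain (2 * c + 2)) with h1 | h1
      · have := h _ (Or.inr (Or.inl (Or.inr
          ⟨2 * c + 2, 0, ⟨c + 1, by ring⟩, by omega, by omega, rfl⟩)))
        rw [x_mul_x_dvd_iff (by omega) (by omega)] at this
        omega
      · have := h _ (Or.inr (Or.inl (Or.inr
          ⟨2 * c, d.extendDomain (2 * c + 2), ⟨c, by ring⟩, by omega, by omega, rfl⟩)))
        rw [x_mul_x_dvd_iff (by omega) (by omega)] at this
        omega
    · rcases Nat.lt_or_ge (d.extendDomain (2 * c + 2)) (j + s) with h1 | h1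
      · have := h _ (Or.inr (Or.inr
          ⟨2 * c, d.extendDomain (2 * c + 2), ⟨c, by ring⟩, by omega, by omega, rfl⟩))
        rw [← pow_one (x F (2 * J + 1) (2 * c + 1)),
          x_mul_x_mul_x_dvd_iff (by omega) (by omega) (by omega)] at this
        omega
      · have := h _ (Or.inr (Or.inl (Or.inl (Or.inr
          ⟨2 * c + 1, ⟨c, rfl⟩, by omega, rfl⟩))))
        nth_rewrite 1 [← pow_one (x F (2 * J + 1) (2 * c + 1))] at this
        rw [x_mul_x_dvd_iff (by omega) (by omega), show 2 * c + 1 + 1 = 2 * c + 2 from rfl] at this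
        omega
  · rintro ⟨-, h2, h3, h4⟩ f hf
    rcases hf with (rfl | rfl | rfl) |
      (((⟨m, hm, hJ, rfl⟩ | ⟨m, hm, hJ, rfl⟩) | ⟨m, n, hm, hJ, hn, rfl⟩) |
        ⟨m, n, hm, hJ, hn, rfl⟩)
    · rw [x_dvd_iff (by omega)]
      have := h2 (2 * J + 1) ⟨J, rfl⟩
      omega
    · nth_rewrite 1 [← pow_one (x F (2 * J + 1) (2 * J + 1))]
      rw [x_mul_x_dvd_iff (by omega) (by omega)]
      omega
    · rw [x_dvd_iff (by omega)]
      omega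
    · rw [x_dvd_iff (by omega)]
      have := h2 m hm
      omega
    · nth_rewrite 1 [← pow_one (x F (2 * J + 1) m)]
      rw [x_mul_x_dvd_iff (by omega) (by omega)]
      obtain ⟨c, rfl⟩ := hm
      have := h4 c (by omega)
      rw [show 2 * c + 1 + 1 = 2 * c + 2 from rfl]
      omega
    · rw [x_mul_x_dvd_iff (by omega) (by omega)]
      obtain ⟨c, rfl⟩ := hm
      have := h4 c (by omega)
      rw [← two_mul]
      omega
    · rw [← pow_one (x F (2 * J + 1) (m + 1)),
        x_mul_x_mul_x_dvd_iff (by omega) (by omega) (by omega)]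
      obtain ⟨c, rfl⟩ := hm
      have := h4 c (by omega)
      rw [← two_mul]
      omega

theorem HP_idealL {j s : ℕ} (hr : 1 ≤ j + s) (J : ℕ) :
    HP F (2 * J + 1) (idealL F (j + s + 1) (j + 1) J) = genFun (admissibleMults J j s) := by
  rw [idealL, Nat.add_sub_cancel]
  ext n
  rw [HP, genFun, PowerSeries.coeff_mk, PowerSeries.coeff_mk, finrank_quotientPart_span (fun f hf => exists_monomial_of_mem hf)]
  have hinj : Function.Injective
      (Finsupp.extendDomain : ({n : ℕ // 2 * J + 1 ≤ n} →₀ ℕ) → ℕ →₀ ℕ) :=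
    Function.LeftInverse.injective Finsupp.subtypeDomain_extendDomain
  have hw : ∀ d : {n : ℕ // 2 * J + 1 ≤ n} →₀ ℕ, Finsupp.weight (id : ℕ → ℕ) d.extendDomain =
      Finsupp.weight (fun n : {n : ℕ // 2 * J + 1 ≤ n} => (n : ℕ)) d := fun d => by
    rw [Finsupp.extendDomain_eq_embDomain_subtype, Finsupp.weight_apply, Finsupp.weight_apply,
      Finsupp.sum_embDomain]
    rfl
  rw [← Set.ncard_image_of_injective _ hinj]
  congr 2
  ext d
  simp only [Set.mem_image, Set.mem_ofPred_eq]
  constructor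
  · rintro ⟨e, ⟨h1, h2⟩, rfl⟩
    exact ⟨(avoids_iff hr e).mp h1, (hw e).trans h2⟩
  · rintro ⟨h1, h2⟩
    have hd : (d.subtypeDomain (2 * J + 1 ≤ ·)).extendDomain = d :=
      Finsupp.extendDomain_subtypeDomain d fun a ha => by
        by_contra hlt
        exact Finsupp.mem_support_iff.mp ha (h1.1 a (by omega))
    refine ⟨_, ⟨(avoids_iff hr _).mpr ?_, ?_⟩, hd⟩
    · rwa [hd]
    · rwa [← hw, hd]

/-- The generating sets differ only in generators starting with a power `x_{2J+2}^e`. Those with `e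
< i` are listed on both sides, and those with `e ≥ i` are multiples of `x_{2J+2}^i`. -/
theorem idealLevel_eq_idealL {r i : ℕ} (hr : 2 ≤ r) (hi : 1 ≤ i) (hir : i ≤ r) (J : ℕ) :
    idealLevel F r (2 * J + 1) i = idealL F r i J := by
  have hodd : ¬ Even (2 * J + 1) := by simp
  rw [idealLevel, if_neg hodd, idealL, show 2 * J + 1 + 1 = 2 * J + 2 from rfl]
  apply le_antisymm
  · rw [Ideal.span_le]
    rintro f ((rfl | rfl) | ((rfl | ⟨e, he, hei, rfl⟩) | ⟨e, he, hei, rfl⟩) |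
      (((⟨m, hm, hJ, rfl⟩ | ⟨m, hm, hJ, rfl⟩) | ⟨m, n, hm, hJ, hn, rfl⟩) |
        ⟨m, n, hm, hJ, hn, rfl⟩))
    · exact Ideal.subset_span (Or.inl (Or.inl rfl))
    · exact Ideal.subset_span (Or.inl (Or.inr (Or.inl rfl)))
    · exact Ideal.subset_span (Or.inl (Or.inr (Or.inr rfl)))
    · refine Ideal.subset_span (Or.inr (Or.inl (Or.inr
        ⟨2 * J + 2, r - e, ⟨J + 1, by ring⟩, le_rfl, by omega, ?_⟩)))
      rw [show r - (r - e) = e by omega]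
    · refine Ideal.subset_span (Or.inr (Or.inr
        ⟨2 * J + 2, r - 1 - e, ⟨J + 1, by ring⟩, le_rfl, by omega, ?_⟩))
      rw [show r - (r - 1 - e) - 1 = e by omega]
    · exact Ideal.subset_span (Or.inr (Or.inl (Or.inl (Or.inl ⟨m, hm, by omega, rfl⟩))))
    · exact Ideal.subset_span (Or.inr (Or.inl (Or.inl (Or.inr ⟨m, hm, by omega, rfl⟩))))
    · exact Ideal.subset_span (Or.inr (Or.inl (Or.inr ⟨m, n, hm, by omega, hn, rfl⟩)))
    · exact Ideal.subset_span (Or.inr (Or.inr ⟨m, n, hm, by omega, hn, rfl⟩))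
  · rw [Ideal.span_le]
    rintro f ((rfl | rfl | rfl) |
      (((⟨m, hm, hJ, rfl⟩ | ⟨m, hm, hJ, rfl⟩) | ⟨m, n, hm, hJ, hn, rfl⟩) |
        ⟨m, n, hm, hJ, hn, rfl⟩))
    · exact Ideal.subset_span (Or.inl (Or.inl rfl))
    · exact Ideal.subset_span (Or.inl (Or.inr rfl))
    · exact Ideal.subset_span (Or.inr (Or.inl (Or.inl (Or.inl rfl))))
    · have : m ≠ 2 * J + 2 := by rintro rfl; rcases hm with ⟨k, hk⟩; omega
      exact Ideal.subset_span (Or.inr (Or.inr (Or.inl (Or.inl (Or.inl ⟨m, hm, by omega, rfl⟩)))))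
    · have : m ≠ 2 * J + 2 := by rintro rfl; rcases hm with ⟨k, hk⟩; omega
      exact Ideal.subset_span (Or.inr (Or.inr (Or.inl (Or.inl (Or.inr ⟨m, hm, by omega, rfl⟩)))))
    · rcases hJ.eq_or_lt with rfl | hlt
      · rcases Nat.lt_or_ge (r - n) i with hlt | hge
        · refine Ideal.subset_span (Or.inr (Or.inl (Or.inl (Or.inr
            ⟨r - n, by omega, by omega, ?_⟩))))
          rw [show r - (r - n) = n by omega]
        · exact Ideal.mem_of_dvd _ ((pow_dvd_pow _ hge).mul_right _)
            (Ideal.subset_span (Or.inr (Or.inl (Or.inl (Or.inl rfl)))))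
      · exact Ideal.subset_span (Or.inr (Or.inr (Or.inl (Or.inr ⟨m, n, hm, by omega, hn, rfl⟩))))
    · rcases hJ.eq_or_lt with rfl | hlt
      · rcases Nat.lt_or_ge (r - n - 1) i with hlt | hge
        · refine Ideal.subset_span (Or.inr (Or.inl (Or.inr
            ⟨r - n - 1, by omega, by omega, ?_⟩)))
          rw [show r - 1 - (r - n - 1) = n by omega]
        · exact Ideal.mem_of_dvd _ (((pow_dvd_pow _ hge).mul_right _).mul_right _)
            (Ideal.subset_span (Or.inr (Or.inl (Or.inl (Or.inl rfl)))))
      · exact Ideal.subset_span (Or.inr (Or.inr (Or.inr ⟨m, n, hm, by omega, hn, rfl⟩)))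

end Algebra

/-! ### The recursively defined series -/

/-- The recursion defining `seriesPair` is `andrewsSeries_succ` with the roles of `j` and `s`
exchanged, solved for its first level-`(g+1)` term; the exponent there, `2(g+1)s + 2g + 1`, is one
less than `2(g+1)(s+1)`. -/
theorem seriesPair_eq_andrewsSeries (g : ℕ) : ∀ j s : ℕ,
    seriesPair (j + s + 1) g (s + 1) = ((andrewsSeries g j s : ℚ⟦X⟧) : ℚ⸨X⸩) := by
  induction g with
  | zero =>
    intro j s
    rw [seriesPair, productSeries_eq, andrewsSeries]
  | succ g ih =>
    intro j s
    induction s generalizing j with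
    | zero =>
      rw [seriesPair, ← andrewsSeries_zero]
      simpa using ih 0 j
    | succ s ihs =>
      have h1 := ih (s + 1) j
      have h2 := ih s (j + 1)
      have h3 := ihs (j + 1)
      rw [show s + 1 + j + 1 = j + (s + 1) + 1 by ring] at h1
      rw [show s + (j + 1) + 1 = j + (s + 1) + 1 by ring] at h2
      rw [show j + 1 + s + 1 = j + (s + 1) + 1 by ring] at h3
      rw [seriesPair, h3, show j + (s + 1) + 1 - (s + 2) + 1 = j + 1 by omega,
        show j + (s + 1) + 1 - (s + 2) + 2 = j + 1 + 1 by omega, h1, h2, andrewsSeries_succ]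
      have hq : q ≠ 0 := by
        rw [q, Ne, ← PowerSeries.coe_zero, HahnSeries.ofPowerSeries_injective.eq_iff]
        exact PowerSeries.X_ne_zero
      rw [PowerSeries.coe_add, PowerSeries.coe_mul, PowerSeries.coe_pow, PowerSeries.coe_add,
        PowerSeries.coe_mul, show ((PowerSeries.X : ℚ⟦X⟧) : ℚ⸨X⸩) = q from rfl]
      field_simp
      ring

end GGA

/-! ### The main theorem -/

theorem theorem2p5 (F : Type*) [Field F] [CharZero F] (r i J : ℕ)
    (hr : 2 ≤ r) (hi : 1 ≤ i) (hir : i ≤ r) :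
    GGA.calC r ((r - 1) * J + (r - i + 1)) =
        ((GGA.HP F (2 * J + 1) (GGA.idealL F r i J) : PowerSeries ℚ) : LaurentSeries ℚ) ∧
      GGA.HP F (2 * J + 1) (GGA.idealLevel F r (2 * J + 1) i) =
        GGA.HP F (2 * J + 1) (GGA.idealL F r i J) ∧
      GGA.HP F (2 * J + 1) (GGA.idealL F r i J) = GGA.calE r i J ∧
      GGA.calC r ((r - 1) * J + (r - i + 1)) =
        ((GGA.calE r i J : PowerSeries ℚ) : LaurentSeries ℚ) := by
  have hC := GGA.calC_eq_seriesPair hr J (i := r - i + 1) (by omega) (by omega)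
  have hL := GGA.idealLevel_eq_idealL (F := F) hr hi hir J
  obtain ⟨j, rfl⟩ : ∃ j, i = j + 1 := ⟨i - 1, by omega⟩
  obtain ⟨s, rfl⟩ : ∃ s, r = j + s + 1 := ⟨r - j - 1, by omega⟩
  rw [hL, hC, show j + s + 1 - (j + 1) + 1 = s + 1 by omega, GGA.seriesPair_eq_andrewsSeries,
    GGA.HP_idealL (by omega), GGA.calE_eq_genFun, GGA.genFun_admissibleMults_eq_andrewsSeries]
  exact ⟨rfl, rfl, rfl, rfl⟩
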